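/- **Setting.** All systems are finite-dimensional. A state is a density matrix, a Hamiltonian is a Hermitian matrix, and $D(\rho,\sigma)=\frac12\|\rho-\sigma\|_1$ is the trace distance. A channel (completely positive trace-preserving linear map) $\mathcal E$ from a system with Hamiltonian $H$ to a system with Hamiltonian $H'$ is *covariant* if $\mathcal E(e^{-\mathrm iHt}\rho e^{\mathrm iHt})=e^{-\mathrm iH't}\mathcal E(\rho)e^{\mathrm iH't}$ for all states $\rho$ and all $t\in\mathbb R$. For sequences of states $\widehat\rho=\{\rho_m\}_m$, $\widehat\sigma=\{\sigma_m\}_m$ of systems with Hamiltonians $\widehat H=\{H_m\}_m$, $\widehat{H'}=\{H'_m\}_m$ (the systems may vary with $m$), write $(\widehat\rho,\widehat H)\succ_{\mathrm a}(\widehat\sigma,\widehat{H'})$ if for every $\epsilon\in(0,1]$ there are covariant channels $\mathcal E_m$ with $\limsup_{m\to\infty}D(\mathcal E_m(\rho_m),\sigma_m)\le\epsilon$. Let $f:[0,\infty)\to\mathbb R$ be a *regular standard monotone function*: (i) $0\le A\le B$ implies $f(A)\le f(B)$ for all complex matrices $A,B$ of every size; (ii) $f(x)=xf(1/x)$ for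 $x>0$; (iii) $f(1)=1$; (iv) $f(0)=\lim_{x\to0^+}f(x)$; and $f(0)\neq0$. Let $c_f(x,y)=\frac1{yf(x/y)}$ for $x,y>0$, extended continuously to the pairs of nonnegative numbers other than $(0,0)$. The metric adjusted skew information is $$I^f(\rho,H)=\frac{f(0)}2\,\mathrm{Tr}\bigl(\dot\rho\;c_f(L_\rho,R_\rho)(\dot\rho)\bigr),\qquad \dot\rho=\frac{\mathrm d}{\mathrm dt}e^{-\mathrm iHt}\rho e^{\mathrm iHt}\Big|_{t=0},$$ where $L_\rho,R_\rho$ are left and right multiplication by $\rho$; that is, for $\rho=\sum_i\lambda_i|i\rangle\langle i|$, $$I^f(\rho,H)=\frac{f(0)}2\sum_{i,j}(\lambda_i-\lambda_j)^2\,c_f(\lambda_i,\lambda_j)\,|\langle i|H|j\rangle|^2,$$ where terms with $\lambda_i=\lambda_j=0$ are zero. Set $I^f_\epsilon(\rho,H)=\inf\{I^f(\sigma,H): \sigma \text{ a state},\ D(\rho,\sigma)\le\epsilon\}$ and define $$I_+^f(\widehat\rho,\widehat H)=\lim_{\epsilon\to0^+}\limsup_{m\to\infty}\tfrac1mI^f_\epsilon(\rho_m,H_m),\qquad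 I_-^f(\widehat\rho,\widehat H)=\lim_{\epsilon\to0^+}\liminf_{m\to\infty}\tfrac1mI^f_\epsilon(\rho_m,H_m).$$ Let $\phi_{\mathrm{coh}}=|\phi_{\mathrm{coh}}\rangle\langle\phi_{\mathrm{coh}}|$ with $|\phi_{\mathrm{coh}}\rangle=\frac1{\sqrt2}(|0\rangle+|1\rangle)$, $H_{\mathrm{coh}}=|1\rangle\langle1|$, $H_{\mathrm{coh},k}=\sum_{i=1}^k\mathbb I^{\otimes i-1}\otimes H_{\mathrm{coh}}\otimes\mathbb I^{\otimes k-i}$, and for $R\ge0$ let $\widehat{\phi_{\mathrm{coh}}}(R)=\{\phi_{\mathrm{coh}}^{\otimes\lceil Rm\rceil}\}_m$, $\widehat{H_{\mathrm{coh}}}(R)=\{H_{\mathrm{coh},\lceil Rm\rceil}\}_m$. Define $$C_{\mathrm{cost}}(\widehat\rho,\widehat H)=\inf\{R\ge0:(\widehat{\phi_{\mathrm{coh}}}(R),\widehat{H_{\mathrm{coh}}}(R))\succ_{\mathrm a}(\widehat\rho,\widehat H)\},$$ $$C_{\mathrm{dist}}(\widehat\rho,\widehat H)=\sup\{R\ge0:(\widehat\rho,\widehat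 H)\succ_{\mathrm a}(\widehat{\phi_{\mathrm{coh}}}(R),\widehat{H_{\mathrm{coh}}}(R))\}.$$ All four quantities take values in the extended reals ($\inf\emptyset=+\infty$). **Theorem 3.** For every regular standard monotone function $f$ and for any sequence of states $\widehat\rho$ and any sequence of Hamiltonians $\widehat H$, $$C_{\mathrm{cost}}(\widehat\rho,\widehat H)\ \ge\ 4I_+^f(\widehat\rho,\widehat H)\ \ge\ 4I_-^f(\widehat\rho,\widehat H)\ \ge\ C_{\mathrm{dist}}(\widehat\rho,\widehat H).$$ -/

import Mathlib

open Matrix Filter Topology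
open scoped ComplexOrder

namespace Asymmetry

noncomputable section

universe u v

/-- A state of the finite-dimensional quantum system `ℂ^d`: a density matrix. -/
structure QState (d : Type u) [Fintype d] [DecidableEq d] where
  mat : Matrix d d ℂ
  posSemidef : mat.PosSemidef
  trace_eq_one : mat.trace = 1

/-- A Hamiltonian (observable) of the system `ℂ^d`: a Hermitian matrix. -/
structure Hamiltonian (d : Type u) [Fintype d] [DecidableEq d] where
  mat : Matrix d d ℂ
  isHermitian : mat.IsHermitian

/-- The map `𝓔 ⊗ id_k` on matrices over `d × Fin k`. -/
def ampliate {d : Type u} {d' : Type v} (E : Matrix d d ℂ →ₗ[ℂ] Matrix d' d' ℂ) (k : ℕ)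
    (X : Matrix (d × Fin k) (d × Fin k) ℂ) : Matrix (d' × Fin k) (d' × Fin k) ℂ :=
  Matrix.of fun p q => E (Matrix.of fun a b => X (a, p.2) (b, q.2)) p.1 q.1

/-- A quantum channel: a completely positive trace-preserving linear map. -/
structure QChannel (d : Type u) (d' : Type v) [Fintype d] [DecidableEq d]
    [Fintype d'] [DecidableEq d'] where
  toLin : Matrix d d ℂ →ₗ[ℂ] Matrix d' d' ℂ
  completelyPositive : ∀ (k : ℕ) (X : Matrix (d × Fin k) (d × Fin k) ℂ),
    X.PosSemidef → (ampliate toLin k X).PosSemidef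
  tracePreserving : ∀ X : Matrix d d ℂ, (toLin X).trace = X.trace

section OneSystem

variable {d : Type u} [Fintype d] [DecidableEq d]

/-- The trace norm `‖A‖₁ = Tr √(A† A)`, i.e. the sum of the singular values of `A`. -/
def traceNorm (A : Matrix d d ℂ) : ℝ :=
  ∑ i, Real.sqrt ((isHermitian_conjTranspose_mul_self A).eigenvalues i)

/-- The trace distance `D(A, B) = ‖A - B‖₁ / 2`. -/
def traceDist (A B : Matrix d d ℂ) : ℝ := traceNorm (A - B) / 2

/-- `e^{-iHt} X e^{iHt}`. -/
def evolve (H : Hamiltonian d) (t : ℝ) (X : Matrix d d ℂ) : Matrix d d ℂ :=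
  NormedSpace.exp ((-(Complex.I * (t : ℂ))) • H.mat) * X *
    NormedSpace.exp ((Complex.I * (t : ℂ)) • H.mat)

end OneSystem

/-- The channel commutes with the time translations generated by `H` and `H'`. -/
def QChannel.IsCovariant {d : Type u} {d' : Type v} [Fintype d] [DecidableEq d]
    [Fintype d'] [DecidableEq d'] (E : QChannel d d') (H : Hamiltonian d)
    (H' : Hamiltonian d') : Prop :=
  ∀ (ρ : QState d) (t : ℝ), E.toLin (evolve H t ρ.mat) = evolve H' t (E.toLin ρ.mat)

/-- Asymptotic convertibility of sequences by covariant operations: for every `ε ∈ (0, 1]`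
there are covariant channels whose errors in trace distance have limit superior at most `ε`. -/
def AsympConvertible {d : ℕ → Type u} {d' : ℕ → Type v}
    [∀ m, Fintype (d m)] [∀ m, DecidableEq (d m)]
    [∀ m, Fintype (d' m)] [∀ m, DecidableEq (d' m)]
    (ρ : ∀ m, QState (d m)) (H : ∀ m, Hamiltonian (d m))
    (σ : ∀ m, QState (d' m)) (H' : ∀ m, Hamiltonian (d' m)) : Prop :=
  ∀ ε : ℝ, 0 < ε → ε ≤ 1 →
    ∃ E : ∀ m, QChannel (d m) (d' m), (∀ m, (E m).IsCovariant (H m) (H' m)) ∧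
      limsup (fun m => ((traceDist ((E m).toLin (ρ m).mat) (σ m).mat : ℝ) : EReal)) atTop
        ≤ (ε : EReal)

/-! ### Metric adjusted skew information -/

/-- Standard monotone functions on `[0, ∞)`: operator monotone, symmetric and normalized.
As usual, `f 0` is the limit of `f x` as `x` decreases to `0`. -/
structure IsStandardMonotone (f : ℝ → ℝ) : Prop where
  monotone : ∀ (n : ℕ) (A B : Matrix (Fin n) (Fin n) ℂ), A.PosSemidef → (B - A).PosSemidef →
    (cfc f B - cfc f A).PosSemidef
  symm : ∀ x : ℝ, 0 < x → f x = x * f (1 / x)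
  one : f 1 = 1
  tendsto_zero : Tendsto f (𝓝[>] 0) (𝓝 (f 0))

/-- A standard monotone function is regular if `f 0 ≠ 0`. -/
structure IsRegularStandardMonotone (f : ℝ → ℝ) : Prop extends IsStandardMonotone f where
  regular : f 0 ≠ 0

/-- The Morozova–Chentsov function `c_f(x, y) = 1 / (y f(x / y))` for `y ≠ 0`, with its
continuous extension `c_f(x, 0) = 1 / (x f(0))` for `x > 0`.
(The value at `(0, 0)` is `0` and plays no role for unitary models, since the corresponding
matrix entries of the derivative of the state vanish.) -/
def mcFun (f : ℝ → ℝ) (x y : ℝ) : ℝ :=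
  if y = 0 then 1 / (x * f 0) else 1 / (y * f (x / y))

section Skew

variable {d : Type u} [Fintype d] [DecidableEq d]

/-- The superoperator `c_f(L_ρ, R_ρ)`, where `L_ρ` and `R_ρ` are the commuting operators of left
and right multiplication by `ρ`: in an eigenbasis of `ρ` with eigenvalues `λ`, it multiplies the
entry `(i, j)` by `c_f(λ i, λ j)`. -/
def mcOp (f : ℝ → ℝ) (ρ : QState d) (X : Matrix d d ℂ) : Matrix d d ℂ :=
  let hρ := ρ.posSemidef.isHermitian
  let U : Matrix d d ℂ := hρ.eigenvectorUnitary
  U * (Matrix.of fun i j =>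
    ((mcFun f (hρ.eigenvalues i) (hρ.eigenvalues j) : ℝ) : ℂ) * (Uᴴ * X * U) i j) * Uᴴ

/-- The derivative at `t = 0` of the unitary model `ρ_t = e^{-iHt} ρ e^{iHt}`. -/
def unitaryDeriv (ρ : QState d) (H : Hamiltonian d) : Matrix d d ℂ :=
  Matrix.of fun i j => deriv (fun t : ℝ => evolve H t ρ.mat i j) 0

/-- The quantum Fisher information `J^f` of the unitary model at `t = 0`. -/
def fisherInfo (f : ℝ → ℝ) (ρ : QState d) (H : Hamiltonian d) : ℝ :=
  (unitaryDeriv ρ H * mcOp f ρ (unitaryDeriv ρ H)).trace.re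

/-- The metric adjusted skew information `I^f(ρ, H)`. -/
def skewInfo (f : ℝ → ℝ) (ρ : QState d) (H : Hamiltonian d) : ℝ :=
  f 0 / 2 * fisherInfo f ρ H

/-- The `ε`-ball around `ρ` in the state space. -/
def ball (ρ : QState d) (ε : ℝ) : Set (QState d) := {σ | traceDist ρ.mat σ.mat ≤ ε}

/-- The `ε`-smooth metric adjusted skew information. -/
def smoothSkewInfo (f : ℝ → ℝ) (ε : ℝ) (ρ : QState d) (H : Hamiltonian d) : EReal :=
  ⨅ σ ∈ ball ρ ε, ((skewInfo f σ H : ℝ) : EReal)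

lemma smoothSkewInfo_antitone (f : ℝ → ℝ) (ρ : QState d) (H : Hamiltonian d) :
    Antitone fun ε => smoothSkewInfo f ε ρ H := fun _ _ h =>
  biInf_mono fun _ hσ => le_trans hσ h

end Skew

section Rates

variable {d : ℕ → Type u} [∀ m, Fintype (d m)] [∀ m, DecidableEq (d m)]

/-- `limsup_m I_ε^f(ρ_m, H_m) / m`. -/
def supRateAt (f : ℝ → ℝ) (ρ : ∀ m, QState (d m)) (H : ∀ m, Hamiltonian (d m)) (ε : ℝ) : EReal :=
  limsup (fun m : ℕ => ((1 / (m : ℝ) : ℝ) : EReal) * smoothSkewInfo f ε (ρ m) (H m)) atTop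

/-- `liminf_m I_ε^f(ρ_m, H_m) / m`. -/
def infRateAt (f : ℝ → ℝ) (ρ : ∀ m, QState (d m)) (H : ∀ m, Hamiltonian (d m)) (ε : ℝ) : EReal :=
  liminf (fun m : ℕ => ((1 / (m : ℝ) : ℝ) : EReal) * smoothSkewInfo f ε (ρ m) (H m)) atTop

/-- The smooth metric adjusted skew information sup-rate `I_+^f`. -/
def supRate (f : ℝ → ℝ) (ρ : ∀ m, QState (d m)) (H : ∀ m, Hamiltonian (d m)) : EReal :=
  limUnder (𝓝[>] (0 : ℝ)) (supRateAt f ρ H)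

/-- The smooth metric adjusted skew information inf-rate `I_-^f`. -/
def infRate (f : ℝ → ℝ) (ρ : ∀ m, QState (d m)) (H : ∀ m, Hamiltonian (d m)) : EReal :=
  limUnder (𝓝[>] (0 : ℝ)) (infRateAt f ρ H)

lemma supRateAt_antitone (f : ℝ → ℝ) (ρ : ∀ m, QState (d m)) (H : ∀ m, Hamiltonian (d m)) :
    Antitone (supRateAt f ρ H) := fun _ _ h =>
  limsup_le_limsup (Eventually.of_forall fun m =>
    mul_le_mul_of_nonneg_left (smoothSkewInfo_antitone f (ρ m) (H m) h)
      (EReal.coe_nonneg.2 (by positivity)))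

lemma infRateAt_antitone (f : ℝ → ℝ) (ρ : ∀ m, QState (d m)) (H : ∀ m, Hamiltonian (d m)) :
    Antitone (infRateAt f ρ H) := fun _ _ h =>
  liminf_le_liminf (Eventually.of_forall fun m =>
    mul_le_mul_of_nonneg_left (smoothSkewInfo_antitone f (ρ m) (H m) h)
      (EReal.coe_nonneg.2 (by positivity)))

/-- The limit defining the sup-rate exists. -/
lemma tendsto_supRate (f : ℝ → ℝ) (ρ : ∀ m, QState (d m)) (H : ∀ m, Hamiltonian (d m)) :
    Tendsto (supRateAt f ρ H) (𝓝[>] (0 : ℝ)) (𝓝 (supRate f ρ H)) :=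
  tendsto_nhds_limUnder
    ⟨_, (supRateAt_antitone f ρ H).tendsto_nhdsGT 0⟩

/-- The limit defining the inf-rate exists. -/
lemma tendsto_infRate (f : ℝ → ℝ) (ρ : ∀ m, QState (d m)) (H : ∀ m, Hamiltonian (d m)) :
    Tendsto (infRateAt f ρ H) (𝓝[>] (0 : ℝ)) (𝓝 (infRate f ρ H)) :=
  tendsto_nhds_limUnder
    ⟨_, (infRateAt_antitone f ρ H).tendsto_nhdsGT 0⟩

end Rates

/-! ### Copies of a system, coherence bits, coherence cost and distillable coherence -/

section Tensor

variable {d : Type u} {k : ℕ}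

/-- The tensor product `A 0 ⊗ ⋯ ⊗ A (k - 1)` on `(ℂ^d)^{⊗ k}`. -/
def tensorMat (A : Fin k → Matrix d d ℂ) : Matrix (Fin k → d) (Fin k → d) ℂ :=
  Matrix.of fun a b => ∏ j, A j (a j) (b j)

lemma tensorMat_conjTranspose (A : Fin k → Matrix d d ℂ) :
    (tensorMat A)ᴴ = tensorMat fun j => (A j)ᴴ := by
  ext a b
  simp [tensorMat, conjTranspose_apply]

lemma tensorMat_mul [Fintype d] (A B : Fin k → Matrix d d ℂ) :
    tensorMat A * tensorMat B = tensorMat fun j => A j * B j := by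
  ext a b
  simp [tensorMat, mul_apply, Finset.prod_univ_sum, Finset.prod_mul_distrib]

variable [Fintype d] [DecidableEq d]

/-- `ρ^{⊗ k}`. -/
def QState.tensorPow (ρ : QState d) (k : ℕ) : QState (Fin k → d) where
  mat := tensorMat fun _ => ρ.mat
  posSemidef := by
    obtain ⟨B, hB⟩ : ∃ B : Matrix d d ℂ, ρ.mat = Bᴴ * B := by
      open scoped MatrixOrder in
      exact CStarAlgebra.nonneg_iff_eq_star_mul_self.1 ρ.posSemidef.nonneg
    have h : (tensorMat fun _ : Fin k => ρ.mat) =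
        (tensorMat fun _ : Fin k => B)ᴴ * tensorMat fun _ => B := by
      rw [tensorMat_conjTranspose, tensorMat_mul, hB]
    rw [h]
    exact posSemidef_conjTranspose_mul_self _
  trace_eq_one := by
    have h : ∏ _j : Fin k, ∑ i, ρ.mat i i = 1 :=
      Finset.prod_eq_one fun _ _ => ρ.trace_eq_one
    rw [Finset.prod_univ_sum] at h
    simpa [trace, tensorMat] using h

/-- The Hamiltonian `∑ i, 1^{⊗ (i - 1)} ⊗ H ⊗ 1^{⊗ (k - i)}` of `k` copies of a system. -/
def Hamiltonian.copies (H : Hamiltonian d) (k : ℕ) : Hamiltonian (Fin k → d) where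
  mat := ∑ i : Fin k, tensorMat (Function.update (fun _ => (1 : Matrix d d ℂ)) i H.mat)
  isHermitian := by
    rw [IsHermitian, conjTranspose_sum]
    refine Finset.sum_congr rfl fun i _ => ?_
    rw [tensorMat_conjTranspose]
    congr 1
    ext1 j
    by_cases hj : j = i
    · subst hj
      simpa using H.isHermitian.eq
    · simp [Function.update_of_ne hj]

end Tensor

/-- The vector `(|0⟩ + |1⟩) / √2`. -/
def cohVec : Fin 2 → ℂ := fun _ => ((1 / Real.sqrt 2 : ℝ) : ℂ)

/-- The coherence bit `|φ_coh⟩⟨φ_coh|`. -/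
def cohState : QState (Fin 2) where
  mat := vecMulVec cohVec (star cohVec)
  posSemidef := posSemidef_vecMulVec_self_star _
  trace_eq_one := by
    have h : (Real.sqrt 2)⁻¹ * (Real.sqrt 2)⁻¹ = (2 : ℝ)⁻¹ := by
      rw [← mul_inv, Real.mul_self_sqrt (by norm_num)]
    have h' : ((Real.sqrt 2 : ℝ) : ℂ)⁻¹ * ((Real.sqrt 2 : ℝ) : ℂ)⁻¹ = (2 : ℂ)⁻¹ := by
      rw [← Complex.ofReal_inv, ← Complex.ofReal_mul, h]
      norm_num
    simp [trace, vecMulVec_apply, cohVec, h']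

/-- The Hamiltonian `|1⟩⟨1|` of the coherence bit. -/
def cohHamiltonian : Hamiltonian (Fin 2) where
  mat := !![0, 0; 0, 1]
  isHermitian := by
    ext i j
    fin_cases i <;> fin_cases j <;> simp [conjTranspose_apply]

/-- The sequence `φ_coh^{⊗ ⌈R m⌉}`. -/
def cohStates (R : ℝ) (m : ℕ) : QState (Fin ⌈R * m⌉₊ → Fin 2) :=
  cohState.tensorPow ⌈R * m⌉₊

/-- The sequence of the Hamiltonians of `⌈R m⌉` coherence bits. -/
def cohHamiltonians (R : ℝ) (m : ℕ) : Hamiltonian (Fin ⌈R * m⌉₊ → Fin 2) :=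
  cohHamiltonian.copies ⌈R * m⌉₊

section CostDist

variable {d : ℕ → Type u} [∀ m, Fintype (d m)] [∀ m, DecidableEq (d m)]

/-- The coherence cost (`+∞` if no rate suffices). -/
def cohCost (ρ : ∀ m, QState (d m)) (H : ∀ m, Hamiltonian (d m)) : EReal :=
  sInf ((fun R : ℝ => (R : EReal)) ''
    {R : ℝ | 0 ≤ R ∧ AsympConvertible (cohStates R) (cohHamiltonians R) ρ H})

/-- The distillable coherence (possibly `+∞`). -/
def cohDist (ρ : ∀ m, QState (d m)) (H : ∀ m, Hamiltonian (d m)) : EReal :=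
  sSup ((fun R : ℝ => (R : EReal)) ''
    {R : ℝ | 0 ≤ R ∧ AsympConvertible ρ H (cohStates R) (cohHamiltonians R)})

end CostDist

end

end Asymmetry

/-! Both outer inequalities compare a sequence with coherence bits, whose Hamiltonian has variance
`k / 4` in `k` copies.

Everything about `f` is reduced to two scalar bounds on its mean `opMean f x y`: it is at least `f 0
* (x + y)`, and for every `η > 0` at most `(f 0 + η) * (x + y)` plus a multiple of the harmonic mean
`x * y / (x + y)`.

Cost: the lower bound on the mean dominates the skew information by a quarter of the symmetric
logarithmic derivative Fisher information. For the covariant image of a pure state this is at most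
the variance (`skewInfo_map_le`). The image of `k` coherence bits lies in the smoothing ball, so the
smooth skew information is at most `k / 4`.

Distillation: the upper bound on the mean gives a variational lower bound on the skew information
(`le_skewInfo`) whose trial value is linear in the state. Pulled back along a covariant channel, it
becomes the expectation of a fixed observable `witness` in the output state
(`trace_witness_le_skewInfo`). The harmonic term vanishes at a pure target for a suitable trial
operator, so the expectation there is almost `k / 4`, up to the factor `f 0`. The operator norm of
the witness is `O(k)`, by the fourth moment of the binomial distribution, so errors `ε` in trace
distance cost only `O(ε k)`, uniformly in the system. Dividing by `m` and letting the errors tend to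
zero gives the rate. -/

namespace Asymmetry

/-! ### Standard monotone functions -/

section Scalar

/-- The functional calculus of a Hermitian matrix annihilated by `(X - a) (X - b)`. -/
lemma cfc_of_quadratic {n : ℕ} (f : ℝ → ℝ) {A : Matrix (Fin n) (Fin n) ℂ} (hA : A.IsHermitian)
    {a b : ℝ} (hab : a ≠ b) (h : (A - algebraMap ℝ _ a) * (A - algebraMap ℝ _ b) = 0) :
    cfc f A = algebraMap ℝ _ (f a - (f b - f a) / (b - a) * a) +
      ((f b - f a) / (b - a)) • A := by
  have hba : b - a ≠ 0 := sub_ne_zero.2 hab.symm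
  have hspec : spectrum ℝ A ⊆ {a, b} := by
    intro r hr
    have h1 := spectrum.subset_polynomial_aeval A
      ((Polynomial.X - Polynomial.C a) * (Polynomial.X - Polynomial.C b)) ⟨r, hr, rfl⟩
    rw [map_mul, map_sub, map_sub, Polynomial.aeval_X, Polynomial.aeval_C, Polynomial.aeval_C,
      h] at h1
    have : Nontrivial (Matrix (Fin n) (Fin n) ℂ) := by
      by_contra hn
      rw [not_nontrivial_iff_subsingleton] at hn
      rw [spectrum.of_subsingleton] at h1
      exact h1
    rw [spectrum.zero_eq] at h1
    simpa [sub_eq_zero] using h1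
  have hsa : IsSelfAdjoint A := hA
  -- On the spectrum, contained in `{a, b}`, `f` agrees with its affine interpolant.
  rw [cfc_congr (g := fun x => (f a - (f b - f a) / (b - a) * a) + ((f b - f a) / (b - a)) * x),
    cfc_const_add _ _ _ (by fun_prop) hsa, cfc_const_mul_id _ _ hsa]
  intro r hr
  rcases hspec hr with rfl | rfl
  · simp
  · simp only
    field_simp
    ring

variable {f : ℝ → ℝ}

lemma IsStandardMonotone.le_of_le (hf : IsStandardMonotone f) {x y : ℝ} (hx : 0 ≤ x)
    (hxy : x ≤ y) : f x ≤ f y := by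
  have key : ∀ c : ℝ, 0 ≤ c →
      (algebraMap ℝ (Matrix (Fin 1) (Fin 1) ℂ) c).PosSemidef := fun c hc => by
    rw [Algebra.algebraMap_eq_smul_one]
    exact PosSemidef.one.smul hc
  have h := hf.monotone 1 (algebraMap ℝ _ x) (algebraMap ℝ _ y) (key x hx) (by
    rw [← map_sub]
    exact key _ (sub_nonneg.2 hxy))
  rw [cfc_algebraMap, cfc_algebraMap, ← map_sub] at h
  have h2 := h.diag_nonneg (i := 0)
  rw [Matrix.algebraMap_matrix_apply] at h2
  simpa using h2

/-- A trace of operator concavity, obtained from a single pair of 2 × 2 matrices `A ≤ B`: `A` is `t`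
times the projection onto `(s, r)`, `B` is diagonal, and the upper left entries of `f(A) ≤ f(B)` are
compared. -/
lemma IsStandardMonotone.concave_at_zero (hf : IsStandardMonotone f) {x p : ℝ} (hx : 0 < x)
    (hp : 0 < p) (hp2 : p < 1 / 2) :
    (1 - p) * f 0 + p * f (x / (p * (1 + p))) ≤ f x := by
  obtain ⟨s, hs, hsp⟩ : ∃ s : ℝ, 0 < s ∧ s ^ 2 = p :=
    ⟨√p, Real.sqrt_pos.2 hp, Real.sq_sqrt hp.le⟩
  obtain ⟨r, hr, hrp⟩ : ∃ r : ℝ, 0 < r ∧ r ^ 2 = 1 - p :=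
    ⟨√(1 - p), Real.sqrt_pos.2 (by linarith), Real.sq_sqrt (by linarith)⟩
  -- `t` is slightly below `x / p`, which leaves room in the upper left entry of `B - A`; `y` is
  -- then the value at which `B - A` has rank one. The bound `p < 1 / 2` ensures `x ≠ y`.
  set t : ℝ := x / (p * (1 + p)) with ht
  set y : ℝ := x * (1 - p) / p ^ 2 with hy
  have htpos : 0 < t := by positivity
  have hxy : x ≠ y := by
    intro h
    rw [hy, eq_div_iff (by positivity)] at h
    have := mul_left_cancel₀ hx.ne' h
    nlinarith
  have psd : ∀ (c a b : ℝ), 0 ≤ c → (!![((c * a ^ 2 : ℝ) : ℂ), ((c * (a * b) : ℝ) : ℂ);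
      ((c * (a * b) : ℝ) : ℂ), ((c * b ^ 2 : ℝ) : ℂ)] : Matrix (Fin 2) (Fin 2) ℂ).PosSemidef := by
    intro c a b hc
    convert (posSemidef_vecMulVec_self_star ![(a : ℂ), (b : ℂ)]).smul hc using 1
    ext i j
    rw [Matrix.smul_apply, vecMulVec_apply]
    fin_cases i <;> fin_cases j <;> simp <;> ring_nf <;> simp
  set A : Matrix (Fin 2) (Fin 2) ℂ := !![((t * s ^ 2 : ℝ) : ℂ), ((t * (s * r) : ℝ) : ℂ);
      ((t * (s * r) : ℝ) : ℂ), ((t * r ^ 2 : ℝ) : ℂ)] with hA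
  set B : Matrix (Fin 2) (Fin 2) ℂ := !![(x : ℂ), 0; 0, (y : ℂ)] with hB
  have hApsd : A.PosSemidef := psd t s r htpos.le
  have hBherm : B.IsHermitian := by
    ext i j
    fin_cases i <;> fin_cases j <;> simp [hB, conjTranspose_apply]
  have hBA : (B - A).PosSemidef := by
    convert psd (x / (1 + p)) s (-(r / p)) (by positivity) using 1
    have e1 : x - t * s ^ 2 = x / (1 + p) * s ^ 2 := by
      rw [ht, hsp]; field_simp; ring
    have e2 : -(t * (s * r)) = x / (1 + p) * (s * -(r / p)) := by
      rw [ht]; field_simp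
    have e3 : y - t * r ^ 2 = x / (1 + p) * (-(r / p)) ^ 2 := by
      rw [neg_sq, div_pow, hrp, hy, ht]; field_simp; ring
    rw [← e1, ← e2, ← e3, hA, hB]
    ext i j
    fin_cases i <;> fin_cases j <;> simp
  have h := hf.monotone 2 A B hApsd hBA
  rw [cfc_of_quadratic f hApsd.isHermitian htpos.ne (by
      have h1 : s ^ 2 + r ^ 2 = 1 := by rw [hsp, hrp]; ring
      have h2 : (s : ℂ) ^ 2 + (r : ℂ) ^ 2 = 1 := by exact_mod_cast h1
      rw [hA]
      ext i j
      fin_cases i <;> fin_cases j <;>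
        simp [Matrix.mul_apply, Matrix.algebraMap_matrix_apply]
      · linear_combination (t : ℂ) ^ 2 * (s : ℂ) ^ 2 * h2
      · linear_combination (t : ℂ) ^ 2 * (s : ℂ) * (r : ℂ) * h2
      · linear_combination (t : ℂ) ^ 2 * (s : ℂ) * (r : ℂ) * h2
      · linear_combination (t : ℂ) ^ 2 * (r : ℂ) ^ 2 * h2),
    cfc_of_quadratic f hBherm hxy (by
      rw [hB]
      ext i j
      fin_cases i <;> fin_cases j <;>
        simp [Matrix.mul_apply, Matrix.algebraMap_matrix_apply])] at h
  have h2 := h.diag_nonneg (i := 0)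
  rw [Matrix.sub_apply, Matrix.add_apply, Matrix.add_apply, Matrix.smul_apply, Matrix.smul_apply,
    Matrix.algebraMap_matrix_apply, Matrix.algebraMap_matrix_apply, if_pos rfl, if_pos rfl,
    show B 0 0 = (x : ℂ) from rfl, show A 0 0 = ((t * s ^ 2 : ℝ) : ℂ) from rfl, Complex.coe_algebraMap,
    Complex.real_smul, Complex.real_smul] at h2
  have h3 : 0 ≤ (f x - (f y - f x) / (y - x) * x) + (f y - f x) / (y - x) * x -
      ((f 0 - (f t - f 0) / (t - 0) * 0) + (f t - f 0) / (t - 0) * (t * s ^ 2)) := by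
    exact_mod_cast h2
  have h4 : (f t - f 0) / (t - 0) * (t * s ^ 2) = (f t - f 0) * p := by
    rw [hsp, sub_zero]; field_simp
  rw [h4] at h3
  linarith

/-- Let `p → 0` in `concave_at_zero`: the argument `x / (p * (1 + p))` goes to infinity, where the
symmetry `f t = t * f (1 / t)` turns the second term into `x * f 0`. -/
lemma IsStandardMonotone.zero_mul_add_le_of_pos (hf : IsStandardMonotone f) {x : ℝ}
    (hx : 0 < x) : f 0 * (1 + x) ≤ f x := by
  have hid : Tendsto (fun p : ℝ => p) (𝓝[>] 0) (𝓝 0) := nhdsWithin_le_nhds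
  have hlim : Tendsto (fun p : ℝ => (1 - p) * f 0 + x / (1 + p) * f (p * (1 + p) / x)) (𝓝[>] 0)
      (𝓝 ((1 - 0) * f 0 + x / (1 + 0) * f 0)) := by
    refine ((tendsto_const_nhds.sub hid).mul_const _).add
      ((tendsto_const_nhds.div (tendsto_const_nhds.add hid) (by norm_num)).mul
        (hf.tendsto_zero.comp ?_))
    refine tendsto_nhdsWithin_iff.2 ⟨?_, ?_⟩
    · have : Tendsto (fun p : ℝ => p * (1 + p) / x) (𝓝[>] 0) (𝓝 (0 * (1 + 0) / x)) :=
        (hid.mul (tendsto_const_nhds.add hid)).div_const _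
      simpa using this
    · filter_upwards [self_mem_nhdsWithin] with p (hp : 0 < p)
      exact Set.mem_Ioi.2 (by positivity)
  have h := le_of_tendsto hlim (b := f x) (by
    filter_upwards [Ioo_mem_nhdsGT (show (0 : ℝ) < 1 / 2 by norm_num)] with p hp
    have hp0 := hp.1
    refine le_trans (le_of_eq ?_) (hf.concave_at_zero hx hp.1 hp.2)
    rw [hf.symm (x / (p * (1 + p))) (by positivity), one_div_div]
    field_simp)
  linarith

lemma IsRegularStandardMonotone.zero_pos (hf : IsRegularStandardMonotone f) : 0 < f 0 := by
  refine lt_of_le_of_ne (ge_of_tendsto hf.tendsto_zero ?_) hf.regular.symm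
  filter_upwards [Ioo_mem_nhdsGT (show (0 : ℝ) < 1 by norm_num)] with x hx
  have hx0 := hx.1
  rw [hf.symm x hx0]
  have h1 : f 1 ≤ f (1 / x) :=
    hf.le_of_le zero_le_one (by rw [le_div_iff₀ hx0]; linarith [hx.2])
  rw [hf.one] at h1
  nlinarith

lemma IsRegularStandardMonotone.zero_mul_add_le (hf : IsRegularStandardMonotone f) {x : ℝ}
    (hx : 0 ≤ x) : f 0 * (1 + x) ≤ f x := by
  rcases hx.eq_or_lt with rfl | hx
  · simp
  · exact hf.zero_mul_add_le_of_pos hx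

/-- A standard monotone function is bounded by the arithmetic mean with coefficient close to
`f 0`, up to a multiple of the harmonic mean. -/
lemma IsRegularStandardMonotone.exists_le_add (hf : IsRegularStandardMonotone f) {η : ℝ}
    (hη : 0 < η) : ∃ C : ℝ, 0 ≤ C ∧
      ∀ x : ℝ, 0 ≤ x → f x ≤ (f 0 + η) * (1 + x) + C * (x / (1 + x)) := by
  have h0 := hf.zero_pos
  obtain ⟨δ, hδ, hδη⟩ : ∃ δ : ℝ, 0 < δ ∧ f δ ≤ f 0 + η := by
    have h1 : ∀ᶠ x in 𝓝[>] (0 : ℝ), f x < f 0 + η :=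
      hf.tendsto_zero.eventually (gt_mem_nhds (by linarith))
    obtain ⟨δ, h2, h3⟩ := (h1.and self_mem_nhdsWithin).exists
    exact ⟨δ, h3, h2.le⟩
  have hM : 0 ≤ f (1 / δ) := by
    have := hf.zero_mul_add_le (x := 1 / δ) (by positivity)
    refine le_trans ?_ this
    positivity
  -- For `x ≤ δ`, and by symmetry for `x ≥ 1 / δ`, the arithmetic term alone suffices. In between,
  -- `f x ≤ f (1 / δ)` and `x / (1 + x) ≥ δ / (1 + δ)`, which fixes the constant.
  refine ⟨f (1 / δ) * ((1 + δ) / δ), by positivity, fun x hx => ?_⟩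
  rcases le_total x δ with h | h
  · have h1 := hf.le_of_le hx h
    have h2 : 0 ≤ f (1 / δ) * ((1 + δ) / δ) * (x / (1 + x)) := by positivity
    nlinarith
  have hx' : 0 < x := hδ.trans_le h
  rcases le_total (1 / δ) x with h' | h'
  · have h1 : f (1 / x) ≤ f δ :=
      hf.le_of_le (by positivity) (by rw [div_le_iff₀ hx']; rwa [div_le_iff₀ hδ, mul_comm] at h')
    have h2 : 0 ≤ f (1 / δ) * ((1 + δ) / δ) * (x / (1 + x)) := by positivity
    rw [hf.symm x hx']
    nlinarith
  · have h1 := hf.le_of_le hx h'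
    have h2 : 1 ≤ (1 + δ) / δ * (x / (1 + x)) := by
      rw [div_mul_div_comm, le_div_iff₀ (by positivity)]
      nlinarith
    have h3 : 0 ≤ (f 0 + η) * (1 + x) := by positivity
    nlinarith

/-- The mean `y f (x / y)` associated with `f`, extended to `y = 0`. -/
noncomputable def opMean (f : ℝ → ℝ) (x y : ℝ) : ℝ := if y = 0 then x * f 0 else y * f (x / y)

lemma mcFun_eq_inv (f : ℝ → ℝ) (x y : ℝ) : mcFun f x y = (opMean f x y)⁻¹ := by
  unfold mcFun opMean
  split_ifs <;> rw [one_div]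

lemma IsRegularStandardMonotone.le_opMean (hf : IsRegularStandardMonotone f) {x y : ℝ}
    (hx : 0 ≤ x) (hy : 0 ≤ y) : f 0 * (x + y) ≤ opMean f x y := by
  unfold opMean
  split_ifs with h
  · subst h; linarith
  · have hy' : 0 < y := lt_of_le_of_ne hy (Ne.symm h)
    have h1 := mul_le_mul_of_nonneg_left (hf.zero_mul_add_le (x := x / y) (by positivity)) hy
    refine le_trans (le_of_eq ?_) h1
    field_simp
    ring

lemma IsRegularStandardMonotone.exists_opMean_le (hf : IsRegularStandardMonotone f) {η : ℝ}
    (hη : 0 < η) : ∃ C : ℝ, 0 ≤ C ∧ ∀ x y : ℝ, 0 ≤ x → 0 ≤ y →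
      opMean f x y ≤ (f 0 + η) * (x + y) + C * (x * y / (x + y)) := by
  obtain ⟨C, hC, h⟩ := hf.exists_le_add hη
  refine ⟨C, hC, fun x y hx hy => ?_⟩
  unfold opMean
  split_ifs with h'
  · subst h'
    simp only [add_zero, mul_zero, zero_div]
    nlinarith
  · have hy' : 0 < y := lt_of_le_of_ne hy (Ne.symm h')
    refine le_trans (mul_le_mul_of_nonneg_left (h (x / y) (by positivity)) hy) (le_of_eq ?_)
    have : 0 < x + y := by positivity
    have : 0 < 1 + x / y := by positivity
    field_simp
    ring

end Scalar

/-! ### The derivative of the unitary model -/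

section Derivative

variable {d : Type*} [Fintype d] [DecidableEq d]

/-- `-i [H, A]`, the derivative of `e^{-iHt} A e^{iHt}` at `t = 0`. -/
noncomputable def commDeriv (H : Hamiltonian d) (A : Matrix d d ℂ) : Matrix d d ℂ :=
  (-Complex.I) • (H.mat * A - A * H.mat)

open scoped Matrix.Norms.L2Operator in
lemma hasDerivAt_evolve (H : Hamiltonian d) (X : Matrix d d ℂ) :
    HasDerivAt (fun t : ℝ => evolve H t X) (commDeriv H X) 0 := by
  have h1 := hasDerivAt_exp_smul_const ((-Complex.I) • H.mat) (0 : ℝ)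
  have h2 := hasDerivAt_exp_smul_const (Complex.I • H.mat) (0 : ℝ)
  have h3 := (h1.mul_const X).mul h2
  have e1 : (fun t : ℝ => evolve H t X) =
      (fun y : ℝ => NormedSpace.exp (y • -Complex.I • H.mat) * X) *
        fun u : ℝ => NormedSpace.exp (u • Complex.I • H.mat) := by
    ext1 t
    simp only [evolve, Pi.mul_apply]
    rw [← Complex.coe_smul, ← Complex.coe_smul, smul_smul, smul_smul, mul_comm Complex.I,
      mul_neg]
  have e2 : commDeriv H X =
      NormedSpace.exp ((0 : ℝ) • -Complex.I • H.mat) * (-Complex.I • H.mat) * X *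
        NormedSpace.exp ((0 : ℝ) • Complex.I • H.mat) +
      NormedSpace.exp ((0 : ℝ) • -Complex.I • H.mat) * X *
        (NormedSpace.exp ((0 : ℝ) • Complex.I • H.mat) * (Complex.I • H.mat)) := by
    rw [zero_smul, zero_smul, NormedSpace.exp_zero, commDeriv, smul_sub]
    simp only [Matrix.one_mul, Matrix.mul_one, Matrix.smul_mul, Matrix.mul_smul]
    rw [neg_smul, neg_smul]
    abel
  rw [e1, e2]
  exact h3

lemma hasDerivAt_evolve_apply (H : Hamiltonian d) (X : Matrix d d ℂ) (i j : d) :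
    HasDerivAt (fun t : ℝ => evolve H t X i j) (commDeriv H X i j) 0 :=
  hasDerivAt_pi.1 (hasDerivAt_pi.1 (hasDerivAt_evolve H X) i) j

lemma unitaryDeriv_eq (ρ : QState d) (H : Hamiltonian d) :
    unitaryDeriv ρ H = commDeriv H ρ.mat := by
  ext i j
  exact (hasDerivAt_evolve_apply H ρ.mat i j).deriv

lemma commDeriv_isHermitian (H : Hamiltonian d) {A : Matrix d d ℂ} (hA : A.IsHermitian) :
    (commDeriv H A).IsHermitian := by
  rw [IsHermitian, commDeriv, conjTranspose_smul, conjTranspose_sub, conjTranspose_mul,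
    conjTranspose_mul, hA.eq, H.isHermitian.eq]
  rw [star_neg, Complex.star_def, Complex.conj_I, neg_neg, neg_smul, ← smul_neg, neg_sub]

/-- Moving the commutator onto the observable makes the derivative term an expectation value in the
state. -/
lemma trace_mul_commDeriv (H : Hamiltonian d) (X A : Matrix d d ℂ) :
    (X * commDeriv H A).trace = (A * ((-Complex.I) • (X * H.mat - H.mat * X))).trace := by
  rw [commDeriv, Matrix.mul_smul, Matrix.mul_smul, trace_smul, trace_smul, mul_sub, mul_sub, trace_sub,
    trace_sub, ← Matrix.mul_assoc, trace_mul_comm (X * H.mat), ← Matrix.mul_assoc X A,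
    trace_mul_comm (X * A), ← Matrix.mul_assoc H.mat, trace_mul_comm (H.mat * X)]

end Derivative

/-! ### The skew information in an eigenbasis -/

section Eigenbasis

variable {d : Type*} [Fintype d] [DecidableEq d]

lemma trace_mul_eq_sum {U : Matrix d d ℂ} (hU : U * Uᴴ = 1) (A B : Matrix d d ℂ) :
    (A * B).trace = ∑ i, ∑ j, (Uᴴ * A * U) i j * (Uᴴ * B * U) j i := by
  have h : (A * B).trace = ((Uᴴ * A * U) * (Uᴴ * B * U)).trace := by
    have : (Uᴴ * A * U) * (Uᴴ * B * U) = Uᴴ * (A * (U * Uᴴ) * B * U) := by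
      simp only [Matrix.mul_assoc]
    rw [this, hU, Matrix.mul_one, trace_mul_comm Uᴴ, Matrix.mul_assoc, hU,
      Matrix.mul_one]
  rw [h]
  simp [trace, mul_apply]

omit [DecidableEq d] in
lemma conjTranspose_conj (U A : Matrix d d ℂ) : (Uᴴ * A * U)ᴴ = Uᴴ * Aᴴ * U := by
  simp [conjTranspose_mul, Matrix.mul_assoc]

/-- A spectral decomposition of a state that computes the Fisher information. -/
structure SpectralData (σ : QState d) where
  U : Matrix d d ℂ
  eig : d → ℝ
  mul_conjTranspose : U * Uᴴ = 1
  conjTranspose_mul : Uᴴ * U = 1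
  conj_eq : Uᴴ * σ.mat * U = diagonal fun i => (eig i : ℂ)
  nonneg : ∀ i, 0 ≤ eig i
  fisherInfo_eq : ∀ f H, fisherInfo f σ H =
    ∑ i, ∑ j, (opMean f (eig i) (eig j))⁻¹ *
      Complex.normSq ((Uᴴ * commDeriv H σ.mat * U) i j)

lemma QState.nonempty_spectralData (σ : QState d) : Nonempty (SpectralData σ) := by
  have hσ := σ.posSemidef.isHermitian
  set U : Matrix d d ℂ := (hσ.eigenvectorUnitary : Matrix d d ℂ) with hUdef
  have hU : U * Uᴴ = 1 := Unitary.mul_star_self_of_mem hσ.eigenvectorUnitary.2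
  have hU' : Uᴴ * U = 1 := Unitary.star_mul_self_of_mem hσ.eigenvectorUnitary.2
  refine ⟨⟨U, hσ.eigenvalues, hU, hU', ?_, σ.posSemidef.eigenvalues_nonneg, fun f H => ?_⟩⟩
  · have h := hσ.spectral_theorem
    rw [Unitary.conjStarAlgAut_apply] at h
    have h' : σ.mat = U * diagonal (fun i => (hσ.eigenvalues i : ℂ)) * Uᴴ := h
    have h'' : Uᴴ * σ.mat * U = Uᴴ * (U * diagonal (fun i => (hσ.eigenvalues i : ℂ)) * Uᴴ) * U := by
      rw [← h']
    rw [h'', Matrix.mul_assoc U, ← Matrix.mul_assoc Uᴴ U, hU', Matrix.one_mul, Matrix.mul_assoc,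
      hU', Matrix.mul_one]
  · have hD : (Uᴴ * commDeriv H σ.mat * U)ᴴ = Uᴴ * commDeriv H σ.mat * U := by
      rw [conjTranspose_conj, (commDeriv_isHermitian H hσ).eq]
    set D := Uᴴ * commDeriv H σ.mat * U with hDdef
    have hM : Uᴴ * mcOp f σ (commDeriv H σ.mat) * U = Matrix.of fun i j =>
        ((mcFun f (hσ.eigenvalues i) (hσ.eigenvalues j) : ℝ) : ℂ) * D i j := by
      have : mcOp f σ (commDeriv H σ.mat) = U * (Matrix.of fun i j =>
        ((mcFun f (hσ.eigenvalues i) (hσ.eigenvalues j) : ℝ) : ℂ) * D i j) * Uᴴ := rfl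
      rw [this, Matrix.mul_assoc, Matrix.mul_assoc, hU', Matrix.mul_one, ← Matrix.mul_assoc, hU',
        Matrix.one_mul]
    rw [fisherInfo, unitaryDeriv_eq, trace_mul_comm, trace_mul_eq_sum hU, Complex.re_sum, hM]
    refine Finset.sum_congr rfl fun i _ => ?_
    rw [Complex.re_sum]
    refine Finset.sum_congr rfl fun j _ => ?_
    have hji : D j i = star (D i j) := by
      conv_lhs => rw [← hD]
      rfl
    rw [Matrix.of_apply, ← hDdef, hji, mul_assoc, Complex.star_def, Complex.mul_conj, mcFun_eq_inv,
      ← Complex.ofReal_mul, Complex.ofReal_re]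

namespace SpectralData

variable {σ : QState d} (S : SpectralData σ)

/-- The matrix of `A` in the eigenbasis. -/
def conj (A : Matrix d d ℂ) : Matrix d d ℂ := S.Uᴴ * A * S.U

lemma conj_conjTranspose (A : Matrix d d ℂ) : S.conj Aᴴ = (S.conj A)ᴴ :=
  (conjTranspose_conj _ _).symm

lemma conj_mul (A B : Matrix d d ℂ) : S.conj (A * B) = S.conj A * S.conj B := by
  have : S.conj A * S.conj B = S.Uᴴ * (A * (S.U * S.Uᴴ) * B) * S.U := by
    simp only [conj, Matrix.mul_assoc]
  rw [this, S.mul_conjTranspose, Matrix.mul_one, conj]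

lemma conj_state : S.conj σ.mat = diagonal fun i => (S.eig i : ℂ) := S.conj_eq

lemma exists_conj_eq (A : Matrix d d ℂ) : ∃ X, S.conj X = A := by
  refine ⟨S.U * A * S.Uᴴ, ?_⟩
  rw [conj, Matrix.mul_assoc, Matrix.mul_assoc, S.conjTranspose_mul, Matrix.mul_one,
    ← Matrix.mul_assoc, S.conjTranspose_mul, Matrix.one_mul]

lemma conj_injective : Function.Injective S.conj := by
  intro A B h
  have key : ∀ A, S.U * S.conj A * S.Uᴴ = A := fun A => by
    rw [conj, Matrix.mul_assoc, Matrix.mul_assoc, S.mul_conjTranspose, Matrix.mul_one,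
      ← Matrix.mul_assoc, S.mul_conjTranspose, Matrix.one_mul]
  rw [← key A, ← key B, h]

lemma trace_mul_conjTranspose (A B : Matrix d d ℂ) :
    (A * Bᴴ).trace.re = ∑ i, ∑ j, (S.conj A i j * star (S.conj B i j)).re := by
  rw [trace_mul_eq_sum S.mul_conjTranspose, Complex.re_sum]
  refine Finset.sum_congr rfl fun i _ => ?_
  rw [Complex.re_sum]
  refine Finset.sum_congr rfl fun j _ => ?_
  rw [← conjTranspose_conj]
  rfl

lemma trace_state_mul (A : Matrix d d ℂ) :
    (σ.mat * A * Aᴴ).trace.re = ∑ i, ∑ j, S.eig i * Complex.normSq (S.conj A i j) := by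
  rw [S.trace_mul_conjTranspose, S.conj_mul, S.conj_state]
  refine Finset.sum_congr rfl fun i _ => Finset.sum_congr rfl fun j _ => ?_
  rw [diagonal_mul, mul_assoc, Complex.star_def, Complex.mul_conj, ← Complex.ofReal_mul,
    Complex.ofReal_re]

lemma trace_state_mul' {A : Matrix d d ℂ} (hA : A.IsHermitian) :
    2 * (σ.mat * A * Aᴴ).trace.re =
      ∑ i, ∑ j, (S.eig i + S.eig j) * Complex.normSq (S.conj A i j) := by
  have h : (σ.mat * A * Aᴴ).trace.re =
      ∑ i, ∑ j, S.eig j * Complex.normSq (S.conj A i j) := by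
    rw [S.trace_state_mul, Finset.sum_comm]
    refine Finset.sum_congr rfl fun i _ => Finset.sum_congr rfl fun j _ => ?_
    have : S.conj A j i = star (S.conj A i j) := by
      conv_lhs => rw [← hA.eq, S.conj_conjTranspose]
      rfl
    rw [this, Complex.star_def, Complex.normSq_conj]
  rw [two_mul]
  nth_rewrite 1 [S.trace_state_mul]
  rw [h]
  simp only [← Finset.sum_add_distrib, add_mul]

/-- In the eigenbasis the commutator with the state multiplies entry `(i, j)` of `H` by an
eigenvalue difference. This disposes of pairs of zero eigenvalues, where the mean vanishes and its
inverse is the default value `0`. -/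
lemma conj_commDeriv_eq_zero (H : Hamiltonian d) {i j : d} (h : S.eig i = S.eig j) :
    S.conj (commDeriv H σ.mat) i j = 0 := by
  have : S.conj (commDeriv H σ.mat) =
      (-Complex.I) • (S.conj H.mat * S.conj σ.mat - S.conj σ.mat * S.conj H.mat) := by
    rw [← S.conj_mul, ← S.conj_mul]
    simp only [conj, commDeriv, Matrix.mul_smul, Matrix.smul_mul, Matrix.mul_sub, Matrix.sub_mul]
  rw [this, S.conj_state, Matrix.smul_apply, Matrix.sub_apply, mul_diagonal, diagonal_mul, h,
    mul_comm, sub_self, smul_zero]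

end SpectralData

end Eigenbasis

/-! ### Variational bounds on the skew information -/

section Variational

variable {d : Type*} [Fintype d] [DecidableEq d] {f : ℝ → ℝ}

lemma two_mul_re_mul_star_le (x y : ℂ) {m : ℝ} (hm : 0 < m) :
    2 * (x * star y).re - m * Complex.normSq x ≤ m⁻¹ * Complex.normSq y := by
  have h : m⁻¹ * Complex.normSq y - 2 * (x * star y).re + m * Complex.normSq x =
      m⁻¹ * ((y.re - m * x.re) ^ 2 + (y.im - m * x.im) ^ 2) := by
    simp only [Complex.normSq_apply, Complex.star_def, Complex.mul_re, Complex.conj_re,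
      Complex.conj_im]
    field_simp
    ring
  have : 0 ≤ m⁻¹ * ((y.re - m * x.re) ^ 2 + (y.im - m * x.im) ^ 2) := by positivity
  linarith

/-- Cauchy–Schwarz: the left side is the minimum of the right side over all splittings of `x + y`.
It replaces the harmonic mean, which is not linear in the state, by terms containing one eigenvalue
each. -/
lemma harmonic_mul_normSq_add_le (x y : ℂ) {a b : ℝ} (ha : 0 ≤ a) (hb : 0 ≤ b) :
    a * b / (a + b) * Complex.normSq (x + y) ≤ a * Complex.normSq x + b * Complex.normSq y := by
  rcases (add_nonneg ha hb).eq_or_lt with h | h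
  · rw [← h, div_zero, zero_mul]
    exact add_nonneg (mul_nonneg ha (Complex.normSq_nonneg _))
      (mul_nonneg hb (Complex.normSq_nonneg _))
  · rw [div_mul_eq_mul_div, div_le_iff₀ h]
    simp only [Complex.normSq_apply, Complex.add_re, Complex.add_im]
    nlinarith [sq_nonneg (a * x.re - b * y.re), sq_nonneg (a * x.im - b * y.im)]

/-- Completing the square entrywise in the eigenbasis, with the mean replaced by its upper bound.
Splitting the Hermitian trial operator as `Y + Yᴴ` turns the harmonic part into the expectation of
`Y * Yᴴ`, so the whole trial value is linear in `σ`. -/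
lemma le_skewInfo (hf : IsRegularStandardMonotone f) {η C : ℝ}
    (hC : 0 ≤ C) (hm : ∀ x y : ℝ, 0 ≤ x → 0 ≤ y →
      opMean f x y ≤ (f 0 + η) * (x + y) + C * (x * y / (x + y)))
    (σ : QState d) (H : Hamiltonian d) (Y : Matrix d d ℂ) :
    f 0 * (((Y + Yᴴ) * commDeriv H σ.mat).trace.re -
      (f 0 + η) * (σ.mat * (Y + Yᴴ) * (Y + Yᴴ)).trace.re - C * (σ.mat * Y * Yᴴ).trace.re) ≤
      skewInfo f σ H := by
  obtain ⟨S⟩ := σ.nonempty_spectralData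
  have h0 := hf.zero_pos
  have hX : (Y + Yᴴ).IsHermitian := isHermitian_add_transpose_self Y
  have hD := commDeriv_isHermitian H σ.posSemidef.isHermitian
  set X := Y + Yᴴ with hXdef
  set D := commDeriv H σ.mat with hDdef
  have hXc : ∀ i j, S.conj X i j = S.conj Y i j + star (S.conj Y j i) := fun i j => by
    have : S.conj X = S.conj Y + (S.conj Y)ᴴ := by
      rw [← S.conj_conjTranspose]
      simp only [SpectralData.conj, hXdef, Matrix.mul_add, Matrix.add_mul]
    rw [this]
    rfl
  have h1 : (X * D).trace.re = ∑ i, ∑ j, (S.conj X i j * star (S.conj D i j)).re := by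
    rw [← S.trace_mul_conjTranspose, hD.eq]
  have h2 := S.trace_state_mul' hX
  rw [hX.eq] at h2
  have h3 : 2 * (σ.mat * Y * Yᴴ).trace.re = ∑ i, ∑ j,
      (S.eig i * Complex.normSq (S.conj Y i j) + S.eig j * Complex.normSq (S.conj Y j i)) := by
    have h4 : (σ.mat * Y * Yᴴ).trace.re =
      ∑ i, ∑ j, S.eig j * Complex.normSq (S.conj Y j i) := by
      rw [S.trace_state_mul, Finset.sum_comm]
    rw [two_mul]
    nth_rewrite 1 [S.trace_state_mul]
    rw [h4]
    simp only [← Finset.sum_add_distrib]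
  have key : 2 * (X * D).trace.re - ((f 0 + η) * (2 * (σ.mat * X * X).trace.re) +
      C * (2 * (σ.mat * Y * Yᴴ).trace.re)) ≤ fisherInfo f σ H := by
    rw [S.fisherInfo_eq, h1, h2, h3]
    simp only [Finset.mul_sum, ← Finset.sum_add_distrib, ← Finset.sum_sub_distrib]
    refine Finset.sum_le_sum fun i _ => Finset.sum_le_sum fun j _ => ?_
    have hi := S.nonneg i
    have hj := S.nonneg j
    set m := opMean f (S.eig i) (S.eig j) with hmdef
    have h5 : m * Complex.normSq (S.conj X i j) ≤
        (f 0 + η) * ((S.eig i + S.eig j) * Complex.normSq (S.conj X i j)) +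
        C * (S.eig i * Complex.normSq (S.conj Y i j) +
          S.eig j * Complex.normSq (S.conj Y j i)) := by
      have h6 := mul_le_mul_of_nonneg_right (hm _ _ hi hj) (Complex.normSq_nonneg (S.conj X i j))
      have h7 := mul_le_mul_of_nonneg_left
        (harmonic_mul_normSq_add_le (S.conj Y i j) (star (S.conj Y j i)) hi hj) hC
      rw [← hXc, Complex.star_def, Complex.normSq_conj] at h7
      nlinarith
    refine le_trans (sub_le_sub_left h5 _) ?_
    change _ ≤ m⁻¹ * Complex.normSq (S.conj D i j)
    rcases (add_nonneg hi hj).eq_or_lt with h | h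
    · have hi0 : S.eig i = 0 := by linarith
      have hj0 : S.eig j = 0 := by linarith
      have hm0 : m = 0 := by rw [hmdef, hi0, hj0, opMean, if_pos rfl, zero_mul]
      rw [S.conj_commDeriv_eq_zero H (hi0.trans hj0.symm), hm0]
      simp
    · exact two_mul_re_mul_star_le _ _
        ((mul_pos h0 h).trans_le (hf.le_opMean hi hj))
  have := mul_le_mul_of_nonneg_left key (show 0 ≤ f 0 / 2 by positivity)
  unfold skewInfo
  linarith

/-- The skew information is bounded by a variational expression for the quantum Fisher information
of the symmetric logarithmic derivative. -/
lemma exists_skewInfo_le (hf : IsRegularStandardMonotone f) (σ : QState d) (H : Hamiltonian d) :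
    ∃ X : Matrix d d ℂ, X.IsHermitian ∧
      skewInfo f σ H ≤ (X * commDeriv H σ.mat).trace.re - (σ.mat * X * X).trace.re := by
  obtain ⟨S⟩ := σ.nonempty_spectralData
  have h0 := hf.zero_pos
  have hD := commDeriv_isHermitian H σ.posSemidef.isHermitian
  set D := commDeriv H σ.mat with hDdef
  -- Half the symmetric logarithmic derivative, the maximizer of the right side. The inverse is `0`
  -- where both eigenvalues vanish.
  obtain ⟨X, hX⟩ := S.exists_conj_eq
    (Matrix.of fun i j => (((S.eig i + S.eig j)⁻¹ : ℝ) : ℂ) * S.conj D i j)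
  have hXherm : X.IsHermitian := by
    apply S.conj_injective
    rw [S.conj_conjTranspose, hX]
    ext i j
    have : S.conj D i j = star (S.conj D j i) := by
      conv_lhs => rw [← hD.eq, S.conj_conjTranspose]
      rfl
    rw [conjTranspose_apply, Matrix.of_apply, Matrix.of_apply, this, star_mul', Complex.star_def,
      Complex.conj_ofReal, add_comm]
  refine ⟨X, hXherm, ?_⟩
  have h1 : (X * D).trace.re = ∑ i, ∑ j, (S.conj X i j * star (S.conj D i j)).re := by
    rw [← S.trace_mul_conjTranspose, hD.eq]
  have h2 := S.trace_state_mul' hXherm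
  rw [hXherm.eq] at h2
  have key : f 0 * fisherInfo f σ H ≤
      2 * (X * D).trace.re - 2 * (σ.mat * X * X).trace.re := by
    rw [S.fisherInfo_eq, h1, h2]
    simp only [Finset.mul_sum, ← Finset.sum_sub_distrib]
    refine Finset.sum_le_sum fun i _ => Finset.sum_le_sum fun j _ => ?_
    have hi := S.nonneg i
    have hj := S.nonneg j
    change f 0 * ((opMean f (S.eig i) (S.eig j))⁻¹ * Complex.normSq (S.conj D i j)) ≤ _
    rw [hX, Matrix.of_apply, mul_assoc, Complex.star_def, Complex.mul_conj,
      ← Complex.ofReal_mul, Complex.ofReal_re, map_mul, Complex.normSq_ofReal]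
    rcases (add_nonneg hi hj).eq_or_lt with h | h
    · have hi0 : S.eig i = 0 := by linarith
      have hj0 : S.eig j = 0 := by linarith
      rw [S.conj_commDeriv_eq_zero H (hi0.trans hj0.symm)]
      simp
    · have h3 : (opMean f (S.eig i) (S.eig j))⁻¹ ≤ (f 0 * (S.eig i + S.eig j))⁻¹ :=
        inv_anti₀ (mul_pos h0 h) (hf.le_opMean hi hj)
      have h4 := mul_le_mul_of_nonneg_left (mul_le_mul_of_nonneg_right h3
        (Complex.normSq_nonneg (S.conj D i j))) h0.le
      refine h4.trans (le_of_eq ?_)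
      field_simp
      ring
  unfold skewInfo
  linarith

end Variational

/-! ### Channels and their duals -/

section Channel

variable {d d' : Type*} [Fintype d] [DecidableEq d] [Fintype d'] [DecidableEq d']

/-- The block matrix with blocks `(K s)ᴴ σ (K t)`. -/
def blockConj (σ : Matrix d d ℂ) (K : Fin 2 → Matrix d d ℂ) :
    Matrix (d × Fin 2) (d × Fin 2) ℂ :=
  Matrix.of fun p q => ((K p.2)ᴴ * σ * K q.2) p.1 q.1

omit [DecidableEq d] in
lemma blockConj_posSemidef {σ : Matrix d d ℂ} (hσ : σ.PosSemidef) (K : Fin 2 → Matrix d d ℂ) :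
    (blockConj σ K).PosSemidef := by
  convert hσ.conjTranspose_mul_mul_same
    (Matrix.of fun (a : d) (q : d × Fin 2) => K q.2 a q.1) using 1
  ext p q
  simp only [blockConj, of_apply, mul_apply, conjTranspose_apply]

namespace QChannel

variable (E : QChannel d d')

lemma ampliate_blockConj_posSemidef {σ : Matrix d d ℂ} (hσ : σ.PosSemidef)
    (K : Fin 2 → Matrix d d ℂ) :
    (Matrix.of fun p q : d' × Fin 2 =>
      E.toLin ((K p.2)ᴴ * σ * K q.2) p.1 q.1).PosSemidef :=
  E.completelyPositive 2 _ (blockConj_posSemidef hσ K)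

/-- Positivity of `E ⊗ id` on a 2 × 2 block matrix, in scalar form. Suitable `K` and `Y` give the
Kadison–Schwarz inequality. -/
lemma sum_trace_nonneg {σ : Matrix d d ℂ} (hσ : σ.PosSemidef)
    (K : Fin 2 → Matrix d d ℂ) (Y : Fin 2 → Matrix d' d' ℂ) :
    0 ≤ ∑ s, ∑ t, ((Y s)ᴴ * E.toLin ((K s)ᴴ * σ * K t) * Y t).trace := by
  have h := ((E.ampliate_blockConj_posSemidef hσ K).conjTranspose_mul_mul_same
    (Matrix.of fun (p : d' × Fin 2) (b : d') => Y p.2 p.1 b)).trace_nonneg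
  refine h.trans (le_of_eq ?_)
  simp only [trace, diag_apply, mul_apply, conjTranspose_apply, of_apply, Fintype.sum_prod_type,
    Fin.sum_univ_two, Finset.sum_add_distrib, add_mul]
  ring

lemma toLin_conjTranspose (X : Matrix d d ℂ) : E.toLin Xᴴ = (E.toLin X)ᴴ := by
  -- The off-diagonal blocks are `E(X)` and `E(Xᴴ)`, and a positive block matrix is Hermitian.
  have h := (E.ampliate_blockConj_posSemidef PosSemidef.one ![1, X]).isHermitian
  ext i j
  have := congrFun (congrFun h (i, 1)) (j, 0)
  simpa using this.symm

lemma toLin_posSemidef {P : Matrix d d ℂ} (hP : P.PosSemidef) : (E.toLin P).PosSemidef := by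
  have h := (E.ampliate_blockConj_posSemidef hP fun _ => 1).submatrix
    fun i : d' => (i, (0 : Fin 2))
  simp only [conjTranspose_one, Matrix.one_mul, Matrix.mul_one] at h
  exact h

/-- The image of a state. -/
def map (σ : QState d) : QState d' where
  mat := E.toLin σ.mat
  posSemidef := E.toLin_posSemidef σ.posSemidef
  trace_eq_one := (E.tracePreserving _).trans σ.trace_eq_one

/-- The dual (Heisenberg picture) of a channel. -/
def dual (Y : Matrix d' d' ℂ) : Matrix d d ℂ :=
  Matrix.of fun b a => (Y * E.toLin (single a b 1)).trace

lemma trace_dual_mul (Y : Matrix d' d' ℂ) (X : Matrix d d ℂ) :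
    (E.dual Y * X).trace = (Y * E.toLin X).trace := by
  conv_rhs => rw [matrix_eq_sum_single X]
  have h : ∀ a b, single a b (X a b) = X a b • single a b (1 : ℂ) := fun a b => by
    rw [smul_single, smul_eq_mul, mul_one]
  simp only [h, map_sum, map_smul, Matrix.mul_sum, trace_sum, Matrix.mul_smul, trace_smul]
  simp only [trace, diag_apply, mul_apply, dual, of_apply, smul_eq_mul]
  rw [Finset.sum_comm]
  refine Finset.sum_congr rfl fun a _ => Finset.sum_congr rfl fun b _ => ?_
  rw [mul_comm]

lemma dual_conjTranspose (Y : Matrix d' d' ℂ) : E.dual Yᴴ = (E.dual Y)ᴴ := by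
  ext b a
  rw [conjTranspose_apply, dual, dual, of_apply, of_apply, ← trace_conjTranspose,
    conjTranspose_mul, ← toLin_conjTranspose, conjTranspose_single, star_one, trace_mul_comm]

lemma dual_add (Y Z : Matrix d' d' ℂ) : E.dual (Y + Z) = E.dual Y + E.dual Z := by
  ext b a
  simp [dual, Matrix.add_mul]

/-- The Kadison-Schwarz inequality for the dual of a channel, tested on a positive matrix. -/
lemma trace_mul_dual_mul_le {σ : Matrix d d ℂ} (hσ : σ.PosSemidef) (Y : Matrix d' d' ℂ) :
    (σ * E.dual Y * (E.dual Y)ᴴ).trace.re ≤ (E.toLin σ * Y * Yᴴ).trace.re := by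
  set K := E.dual Y with hK
  -- With this choice both cross terms contribute `-Tr(σ K Kᴴ)` and the last diagonal term
  -- contributes `+Tr(σ K Kᴴ)` by trace preservation, so one negative copy remains.
  have h := E.sum_trace_nonneg hσ ![1, K] ![Y, -1]
  simp only [Fin.sum_univ_two, cons_val_zero, cons_val_one, conjTranspose_one, Matrix.one_mul,
    Matrix.mul_one, conjTranspose_neg, Matrix.neg_mul, Matrix.mul_neg, neg_neg, trace_neg,
    E.tracePreserving] at h
  have h1 : (Yᴴ * E.toLin (σ * K)).trace = (σ * K * Kᴴ).trace := by
    rw [← trace_dual_mul, dual_conjTranspose, trace_mul_comm]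
  have h2 : (E.toLin (Kᴴ * σ) * Y).trace = (σ * K * Kᴴ).trace := by
    rw [trace_mul_comm, ← trace_dual_mul, ← hK, trace_mul_comm, Matrix.mul_assoc, trace_mul_comm]
  have h3 : (Kᴴ * σ * K).trace = (σ * K * Kᴴ).trace := by
    rw [Matrix.mul_assoc, trace_mul_comm]
  have h4 : (Yᴴ * E.toLin σ * Y).trace = (E.toLin σ * Y * Yᴴ).trace := by
    rw [Matrix.mul_assoc, trace_mul_comm]
  rw [h1, h2, h3, h4] at h
  have h5 := (Complex.le_def.1 h).1
  simp at h5
  linarith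

/-- Covariance differentiated at `t = 0`. -/
lemma IsCovariant.toLin_commDeriv {E : QChannel d d'} {H : Hamiltonian d} {H' : Hamiltonian d'}
    (hE : E.IsCovariant H H') (σ : QState d) :
    E.toLin (commDeriv H σ.mat) = commDeriv H' (E.map σ).mat := by
  have happ : ∀ X i j, E.toLin X i j = ∑ a, ∑ b, X a b * E.toLin (single a b 1) i j := by
    intro X i j
    conv_lhs => rw [matrix_eq_sum_single X]
    have h : ∀ a b, single a b (X a b) = X a b • single a b (1 : ℂ) := fun a b => by
      rw [smul_single, smul_eq_mul, mul_one]
    simp only [h, map_sum, map_smul, Matrix.sum_apply, Matrix.smul_apply, smul_eq_mul]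
  ext i j
  have h1 := hasDerivAt_evolve_apply H' (E.map σ).mat i j
  have h2 : HasDerivAt (fun t : ℝ => E.toLin (evolve H t σ.mat) i j)
      (E.toLin (commDeriv H σ.mat) i j) 0 := by
    rw [happ _ i j]
    conv in E.toLin _ i j => rw [happ _ i j]
    exact HasDerivAt.fun_sum fun a _ => HasDerivAt.fun_sum fun b _ =>
      (hasDerivAt_evolve_apply H σ.mat a b).mul_const _
  simp only [hE σ] at h2
  exact h2.unique h1

end QChannel

end Channel

/-! ### Trace norm and operator norm -/

section Norm

open scoped Matrix.Norms.L2Operator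

variable {d d' : Type*} [Fintype d] [DecidableEq d] [Fintype d'] [DecidableEq d']

lemma traceNorm_neg (A : Matrix d d ℂ) : traceNorm (-A) = traceNorm A := by
  have h : ∀ (M N : Matrix d d ℂ) (hM : M.IsHermitian) (hN : N.IsHermitian), M = N →
      ∑ i, √(hM.eigenvalues i) = ∑ i, √(hN.eigenvalues i) := by
    rintro M _ hM hN rfl
    rfl
  exact h _ _ _ _ (by rw [conjTranspose_neg, neg_mul_neg])

lemma traceDist_comm (A B : Matrix d d ℂ) : traceDist A B = traceDist B A := by
  rw [traceDist, traceDist, ← traceNorm_neg, neg_sub]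

lemma traceNorm_nonneg (A : Matrix d d ℂ) : 0 ≤ traceNorm A :=
  Finset.sum_nonneg fun _ _ => Real.sqrt_nonneg _

lemma traceDist_nonneg (A B : Matrix d d ℂ) : 0 ≤ traceDist A B :=
  div_nonneg (traceNorm_nonneg _) zero_le_two

lemma norm_mulVec_le (A : Matrix d d ℂ) (x : d → ℂ) :
    ‖WithLp.toLp 2 (A *ᵥ x)‖ ≤ ‖A‖ * ‖WithLp.toLp 2 x‖ :=
  l2_opNorm_mulVec A (WithLp.toLp 2 x)

lemma opNorm_le_of_mulVec {A : Matrix d d ℂ} {c : ℝ} (hc : 0 ≤ c)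
    (h : ∀ x, ‖WithLp.toLp 2 (A *ᵥ x)‖ ≤ c * ‖WithLp.toLp 2 x‖) : ‖A‖ ≤ c := by
  rw [← l2_opNorm_toEuclideanCLM]
  exact ContinuousLinearMap.opNorm_le_bound _ hc fun x => h x.ofLp

omit [DecidableEq d] in
lemma norm_toLp_sq (x : d → ℂ) : ‖WithLp.toLp 2 x‖ ^ 2 = (star x ⬝ᵥ x).re := by
  rw [EuclideanSpace.norm_sq_eq, dotProduct, Complex.re_sum]
  refine Finset.sum_congr rfl fun i _ => ?_
  rw [Pi.star_apply, Complex.star_def, ← Complex.normSq_eq_conj_mul_self, Complex.ofReal_re,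
    Complex.normSq_eq_norm_sq]

/-- Hölder's inequality: in an eigenbasis of `Aᴴ * A`, the vector `A b i` has the `i`-th singular
value as its norm. -/
lemma norm_trace_mul_le (A Z : Matrix d d ℂ) : ‖(A * Z).trace‖ ≤ traceNorm A * ‖Z‖ := by
  have hA := isHermitian_conjTranspose_mul_self A
  set b := hA.eigenvectorBasis with hb
  have hU : (hA.eigenvectorUnitary : Matrix d d ℂ) * (hA.eigenvectorUnitary : Matrix d d ℂ)ᴴ = 1 :=
    Unitary.mul_star_self_of_mem hA.eigenvectorUnitary.2
  have h1 : (A * Z).trace = ∑ i, star (b i).ofLp ⬝ᵥ (Z *ᵥ (A *ᵥ (b i).ofLp)) := by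
    have : (A * Z).trace = ((hA.eigenvectorUnitary : Matrix d d ℂ)ᴴ *
        (Z * (A * (hA.eigenvectorUnitary : Matrix d d ℂ)))).trace := by
      rw [trace_mul_comm _ (Z * _), Matrix.mul_assoc, Matrix.mul_assoc, hU, Matrix.mul_one,
        trace_mul_comm]
    rw [this]
    rfl
  have h2 : ∀ i, ‖star (b i).ofLp ⬝ᵥ (Z *ᵥ (A *ᵥ (b i).ofLp))‖ ≤
      √(hA.eigenvalues i) * ‖Z‖ := by
    intro i
    have h3 : star (b i).ofLp ⬝ᵥ (Z *ᵥ (A *ᵥ (b i).ofLp)) =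
        inner ℂ (b i) (WithLp.toLp 2 (Z *ᵥ (A *ᵥ (b i).ofLp))) := by
      rw [EuclideanSpace.inner_eq_star_dotProduct, dotProduct_comm]
    have h4 : ‖WithLp.toLp 2 (A *ᵥ (b i).ofLp)‖ = √(hA.eigenvalues i) := by
      rw [← Real.sqrt_sq (norm_nonneg (WithLp.toLp 2 (A *ᵥ (b i).ofLp))), norm_toLp_sq,
        star_mulVec, ← Matrix.dotProduct_mulVec, mulVec_mulVec, hA.mulVec_eigenvectorBasis i,
        dotProduct_smul, Complex.smul_re, ← norm_toLp_sq]
      change √(hA.eigenvalues i • ‖b i‖ ^ 2) = _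
      rw [b.norm_eq_one, one_pow, smul_eq_mul, mul_one]
    rw [h3]
    refine (norm_inner_le_norm _ _).trans ?_
    rw [b.norm_eq_one, one_mul, mul_comm]
    refine (norm_mulVec_le Z _).trans_eq ?_
    rw [h4]
  rw [h1, traceNorm, Finset.sum_mul]
  exact (norm_sum_le _ _).trans (Finset.sum_le_sum fun i _ => h2 i)

lemma norm_vecMulVec_le (a b : d → ℂ) :
    ‖vecMulVec a (star b)‖ ≤ ‖WithLp.toLp 2 a‖ * ‖WithLp.toLp 2 b‖ := by
  refine opNorm_le_of_mulVec (by positivity) fun x => ?_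
  have h : WithLp.toLp 2 (vecMulVec a (star b) *ᵥ x) =
      inner ℂ (WithLp.toLp 2 b) (WithLp.toLp 2 x) • WithLp.toLp 2 a := by
    rw [EuclideanSpace.inner_eq_star_dotProduct, vecMulVec_mulVec, dotProduct_comm]
    ext i
    simp [mul_comm]
  rw [h, norm_smul, mul_comm, mul_assoc]
  exact mul_le_mul_of_nonneg_left (norm_inner_le_norm _ _) (norm_nonneg _)

lemma trace_mul_mul_conjTranspose_le {P : Matrix d d ℂ} (hP : P.PosSemidef) (Y : Matrix d d ℂ) :
    (P * Y * Yᴴ).trace.re ≤ ‖Y‖ ^ 2 * P.trace.re := by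
  obtain ⟨B, hB⟩ : ∃ B : Matrix d d ℂ, P = B * Bᴴ := by
    open scoped MatrixOrder in
    obtain ⟨B, hB⟩ := CStarAlgebra.nonneg_iff_eq_star_mul_self.1 hP.nonneg
    exact ⟨Bᴴ, by rw [conjTranspose_conjTranspose]; exact hB⟩
  have frob : ∀ A : Matrix d d ℂ, (Aᴴ * A).trace.re =
      ∑ j, ‖WithLp.toLp 2 fun i => A i j‖ ^ 2 := by
    intro A
    rw [trace, Complex.re_sum]
    exact Finset.sum_congr rfl fun j _ => (norm_toLp_sq _).symm
  have h1 : (P * Y * Yᴴ).trace = ((Yᴴ * B)ᴴ * (Yᴴ * B)).trace := by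
    rw [hB, conjTranspose_mul, conjTranspose_conjTranspose, Matrix.mul_assoc B, Matrix.mul_assoc B,
      trace_mul_comm B]
    simp only [Matrix.mul_assoc]
  have h2 : P.trace = (Bᴴ * B).trace := by rw [hB, trace_mul_comm]
  rw [h1, h2, frob, frob, Finset.mul_sum]
  refine Finset.sum_le_sum fun j _ => ?_
  rw [← mul_pow, ← l2_opNorm_conjTranspose Y]
  exact pow_le_pow_left₀ (norm_nonneg _) (norm_mulVec_le Yᴴ fun i => B i j) 2

/-- Kadison–Schwarz tested on the rank-one matrix of a vector `x`, whose trace the channel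
preserves. -/
lemma QChannel.norm_dual_le (E : QChannel d d') (Y : Matrix d' d' ℂ) : ‖E.dual Y‖ ≤ ‖Y‖ := by
  rw [← l2_opNorm_conjTranspose]
  refine opNorm_le_of_mulVec (norm_nonneg _) fun x => ?_
  refine le_of_sq_le_sq ?_ (by positivity)
  have hP : (vecMulVec x (star x)).PosSemidef := posSemidef_vecMulVec_self_star x
  have h1 := E.trace_mul_dual_mul_le hP Y
  have h2 := trace_mul_mul_conjTranspose_le (E.toLin_posSemidef hP) Y
  rw [E.tracePreserving, trace_vecMulVec, dotProduct_comm, ← norm_toLp_sq] at h2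
  have h3 : (vecMulVec x (star x) * E.dual Y * (E.dual Y)ᴴ).trace.re =
      ‖WithLp.toLp 2 ((E.dual Y)ᴴ *ᵥ x)‖ ^ 2 := by
    rw [norm_toLp_sq, star_mulVec, conjTranspose_conjTranspose, Matrix.mul_assoc, vecMulVec_mul,
      trace_vecMulVec, dotProduct_comm, ← vecMul_vecMul, Matrix.dotProduct_mulVec]
  rw [mul_pow]
  linarith

end Norm

/-! ### Pure states -/

section Pure

variable {d d' : Type*} [Fintype d] [DecidableEq d] [Fintype d'] [DecidableEq d'] {f : ℝ → ℝ}

omit [DecidableEq d] in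
lemma trace_vecMulVec_star_mul (ψ : d → ℂ) (M : Matrix d d ℂ) :
    (vecMulVec ψ (star ψ) * M).trace = star ψ ⬝ᵥ (M *ᵥ ψ) := by
  rw [vecMulVec_mul, trace_vecMulVec, dotProduct_comm, Matrix.dotProduct_mulVec]

omit [DecidableEq d] in
lemma two_mul_norm_dotProduct_le (x y : d → ℂ) :
    2 * ‖star x ⬝ᵥ y‖ ≤ ‖WithLp.toLp 2 x‖ ^ 2 + ‖WithLp.toLp 2 y‖ ^ 2 := by
  have h : star x ⬝ᵥ y = inner ℂ (WithLp.toLp 2 x) (WithLp.toLp 2 y) := by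
    rw [EuclideanSpace.inner_eq_star_dotProduct, dotProduct_comm]
  have h1 := norm_inner_le_norm (𝕜 := ℂ) (WithLp.toLp 2 x) (WithLp.toLp 2 y)
  rw [h]
  nlinarith [sq_nonneg (‖WithLp.toLp 2 x‖ - ‖WithLp.toLp 2 y‖)]

/-- A covariant channel maps a pure state to a state whose skew information is at most the variance
of the Hamiltonian in the pure state. -/
lemma skewInfo_map_le (hf : IsRegularStandardMonotone f) {H : Hamiltonian d} {H' : Hamiltonian d'}
    {E : QChannel d d'} (hE : E.IsCovariant H H') {ρ : QState d} {ψ w : d → ℂ} {h : ℝ}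
    (hρ : ρ.mat = vecMulVec ψ (star ψ)) (hw : H.mat *ᵥ ψ = w + (h : ℂ) • ψ) :
    skewInfo f (E.map ρ) H' ≤ ‖WithLp.toLp 2 w‖ ^ 2 := by
  -- The optimal observable at the output is pulled back to `K`: covariance preserves the derivative
  -- term, and Kadison–Schwarz does not increase the quadratic one.
  obtain ⟨X, hX, hle⟩ := exists_skewInfo_le hf (E.map ρ) H'
  set K := E.dual X with hK
  have hKh : K.IsHermitian := by
    rw [IsHermitian, hK, ← E.dual_conjTranspose, hX.eq]
  have h1 : (X * commDeriv H' (E.map ρ).mat).trace = (K * commDeriv H ρ.mat).trace := by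
    rw [E.trace_dual_mul, hE.toLin_commDeriv]
  have h2 := E.trace_mul_dual_mul_le ρ.posSemidef X
  rw [← hK, hKh.eq, hX.eq] at h2
  have h3 : (ρ.mat * K * K).trace.re = ‖WithLp.toLp 2 (K *ᵥ ψ)‖ ^ 2 := by
    rw [hρ, Matrix.mul_assoc, trace_vecMulVec_star_mul, norm_toLp_sq, star_mulVec, hKh.eq,
      ← Matrix.dotProduct_mulVec, mulVec_mulVec]
  set a := star (K *ᵥ ψ) ⬝ᵥ w with ha
  -- Shifting `H` by a scalar does not change the commutator, so the terms with `h` cancel between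
  -- `e1` and `e2`.
  have h4 : (K * commDeriv H ρ.mat).trace.re = 2 * a.im := by
    have e1 : star ψ ⬝ᵥ (K * H.mat) *ᵥ ψ = a + h * (star ψ ⬝ᵥ (K *ᵥ ψ)) := by
      rw [← mulVec_mulVec, hw, mulVec_add, mulVec_smul, dotProduct_add, dotProduct_smul, ha,
        star_mulVec, hKh.eq, ← Matrix.dotProduct_mulVec, smul_eq_mul]
    have e2 : star ψ ⬝ᵥ (H.mat * K) *ᵥ ψ = star a + h * (star ψ ⬝ᵥ (K *ᵥ ψ)) := by
      have : star ψ ᵥ* H.mat = star w + (h : ℂ) • star ψ := by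
        have := congrArg star hw
        rw [star_mulVec, H.isHermitian.eq] at this
        rw [this, star_add, star_smul, Complex.star_def, Complex.conj_ofReal]
      rw [← mulVec_mulVec, Matrix.dotProduct_mulVec, this, add_dotProduct, smul_dotProduct, ha,
        smul_eq_mul, Matrix.star_dotProduct w]
    rw [trace_mul_commDeriv, hρ, trace_vecMulVec_star_mul, smul_mulVec, sub_mulVec,
      dotProduct_smul, dotProduct_sub, e1, e2]
    simp
    ring
  -- It remains to bound `2 Im ⟨Kψ, w⟩ - ‖Kψ‖²` by `‖w‖²`.
  have h5 := two_mul_norm_dotProduct_le (K *ᵥ ψ) w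
  rw [← ha] at h5
  have h6 := (le_abs_self _).trans (Complex.abs_im_le_norm a)
  rw [h1, h4] at hle
  change skewInfo f (E.map ρ) H' ≤ 2 * a.im - (E.toLin ρ.mat * X * X).trace.re at hle
  linarith

/-- The observable that witnesses the skew information of systems that are mapped to `H` by a
covariant channel. -/
noncomputable def witness (H : Hamiltonian d) (a C : ℝ) (Y : Matrix d d ℂ) : Matrix d d ℂ :=
  (-Complex.I) • ((Y + Yᴴ) * H.mat - H.mat * (Y + Yᴴ)) -
    (a : ℂ) • ((Y + Yᴴ) * (Y + Yᴴ)) - (C : ℂ) • (Y * Yᴴ)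

/-- Data processing for the variational bound: use `E.dual Y` as trial operator at the input. The
derivative term is unchanged by covariance, and both quadratic penalties can only decrease. -/
lemma trace_witness_le_skewInfo (hf : IsRegularStandardMonotone f) {η C : ℝ}
    (hη : 0 ≤ η) (hC : 0 ≤ C) (hm : ∀ x y : ℝ, 0 ≤ x → 0 ≤ y →
      opMean f x y ≤ (f 0 + η) * (x + y) + C * (x * y / (x + y)))
    {H : Hamiltonian d} {H' : Hamiltonian d'} {E : QChannel d d'} (hE : E.IsCovariant H H')
    (σ : QState d) (Y : Matrix d' d' ℂ) :
    f 0 * (E.toLin σ.mat * witness H' (f 0 + η) C Y).trace.re ≤ skewInfo f σ H := by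
  have h0 := hf.zero_pos
  refine le_trans (mul_le_mul_of_nonneg_left ?_ h0.le) (le_skewInfo hf hC hm σ H (E.dual Y))
  have hX : (Y + Yᴴ).IsHermitian := isHermitian_add_transpose_self Y
  set X := Y + Yᴴ with hXdef
  have hd : E.dual Y + (E.dual Y)ᴴ = E.dual X := by
    rw [hXdef, E.dual_add, E.dual_conjTranspose]
  have h1 := E.trace_mul_dual_mul_le σ.posSemidef X
  rw [hX.eq, ← E.dual_conjTranspose, hX.eq] at h1
  have h2 := E.trace_mul_dual_mul_le σ.posSemidef Y
  have h3 : (E.dual X * commDeriv H σ.mat).trace = (X * commDeriv H' (E.map σ).mat).trace := by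
    rw [E.trace_dual_mul, hE.toLin_commDeriv]
  rw [hd, h3, trace_mul_commDeriv]
  change (E.toLin σ.mat * _).trace.re ≤ (E.toLin σ.mat * _).trace.re - _ - _
  rw [witness, ← hXdef, mul_sub, mul_sub, trace_sub, trace_sub, Complex.sub_re, Complex.sub_re,
    Matrix.mul_smul _ (a := (C : ℂ)), Matrix.mul_smul _ (a := ((f 0 + η : ℝ) : ℂ)), trace_smul,
    trace_smul, smul_eq_mul, smul_eq_mul, Complex.re_ofReal_mul, Complex.re_ofReal_mul,
    ← Matrix.mul_assoc (E.toLin σ.mat) X, ← Matrix.mul_assoc (E.toLin σ.mat) Y]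
  have := mul_le_mul_of_nonneg_left h1 (show 0 ≤ f 0 + η by linarith)
  have := mul_le_mul_of_nonneg_left h2 hC
  linarith

open scoped Matrix.Norms.L2Operator in
-- Two replacements, `φ` by `E(ρ)` and `E(ρ)` by `E(σ)`. The second is estimated at the input, where
-- the dual has not increased the norm of `Z`.
lemma trace_mul_sub_le {ρ σ : Matrix d d ℂ} {φ Z : Matrix d' d' ℂ} (E : QChannel d d') :
    (φ * Z).trace.re - ‖Z‖ * (2 * traceDist ρ σ + 2 * traceDist (E.toLin ρ) φ) ≤
      (E.toLin σ * Z).trace.re := by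
  have h1 := (neg_le_of_abs_le ((Complex.abs_re_le_norm _).trans
    (norm_trace_mul_le (E.toLin ρ - φ) Z)))
  have h2 := (le_of_abs_le ((Complex.abs_re_le_norm _).trans
    (norm_trace_mul_le (ρ - σ) (E.dual Z))))
  have h3 : traceNorm (ρ - σ) * ‖E.dual Z‖ ≤ traceNorm (ρ - σ) * ‖Z‖ :=
    mul_le_mul_of_nonneg_left (E.norm_dual_le Z)
      (traceNorm_nonneg _)
  rw [trace_mul_comm, E.trace_dual_mul, trace_mul_comm, map_sub, Matrix.sub_mul, trace_sub,
    Complex.sub_re] at h2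
  rw [Matrix.sub_mul, trace_sub, Complex.sub_re] at h1
  simp only [traceDist]
  linarith

/-! ### The witness for a pure target state -/

section Witness

variable {H : Hamiltonian d} {ψ w u : d → ℂ} {h : ℝ}

omit [DecidableEq d] in
lemma vecMulVec_star_mul_hermitian {A : Matrix d d ℂ} (hA : A.IsHermitian) (x y : d → ℂ) :
    vecMulVec x (star y) * A = vecMulVec x (star (A *ᵥ y)) := by
  rw [vecMulVec_mul, star_mulVec, hA.eq]

omit [DecidableEq d] in
lemma vecMulVec_star_mulVec (x y z : d → ℂ) :
    vecMulVec x (star y) *ᵥ z = (star y ⬝ᵥ z) • x := by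
  rw [vecMulVec_mulVec]
  ext i
  simp [mul_comm]

omit [DecidableEq d] in
lemma vecMulVec_star_mul_vecMulVec (x y z t : d → ℂ) :
    vecMulVec x (star y) * vecMulVec z (star t) = (star y ⬝ᵥ z) • vecMulVec x (star t) := by
  rw [mul_vecMulVec, vecMulVec_star_mulVec, smul_vecMulVec]

/-- The scalar `h` cancels in the commutator, leaving rank-one terms in `ψ`, `w` and `u`. For `k`
coherence bits this permits a norm bound of order `k`, whereas `‖X‖ * ‖H‖` is of order `k ^ (3 /
2)`. -/
lemma witness_eq (hw : H.mat *ᵥ ψ = w + (h : ℂ) • ψ) (hu : H.mat *ᵥ w = u + (h : ℂ) • w)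
    (hψ : star ψ ⬝ᵥ ψ = 1) (hψw : star ψ ⬝ᵥ w = 0) (a c C : ℝ) :
    witness H a C ((-(Complex.I * c)) • vecMulVec w (star ψ)) =
      (c : ℂ) • (vecMulVec u (star ψ) + vecMulVec ψ (star u)
        - vecMulVec w (star w) - vecMulVec w (star w)) -
      ((a * c ^ 2 : ℝ) : ℂ) • (vecMulVec w (star w) + (star w ⬝ᵥ w) • vecMulVec ψ (star ψ)) -
      ((C * c ^ 2 : ℝ) : ℂ) • vecMulVec w (star w) := by
  have hwψ : star w ⬝ᵥ ψ = 0 := by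
    rw [Matrix.star_dotProduct, hψw, star_zero]
  have hY : ((-(Complex.I * c)) • vecMulVec w (star ψ))ᴴ =
      (Complex.I * c) • vecMulVec ψ (star w) := by
    rw [conjTranspose_smul, conjTranspose_vecMulVec, star_star]
    simp
  rw [witness, hY]
  simp only [Matrix.add_mul, Matrix.mul_add, Matrix.smul_mul, Matrix.mul_smul,
    vecMulVec_star_mul_hermitian H.isHermitian, vecMulVec_star_mul_vecMulVec,
    mul_vecMulVec H.mat, hw, hu, hψ, hψw, hwψ]
  ext i j
  simp only [Matrix.sub_apply, Matrix.add_apply, Matrix.smul_apply, vecMulVec_apply, Pi.star_apply,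
    Pi.add_apply, Pi.smul_apply, star_add, star_mul', smul_eq_mul, Complex.star_def,
    Complex.conj_ofReal]
  push_cast
  linear_combination (c * (2 * (w i * (starRingEnd ℂ) (w j)) - u i * (starRingEnd ℂ) (ψ j) -
      ψ i * (starRingEnd ℂ) (u j)) +
    a * c ^ 2 * (w i * (starRingEnd ℂ) (w j) +
      (star w ⬝ᵥ w) * (ψ i * (starRingEnd ℂ) (ψ j))) +
    C * c ^ 2 * (w i * (starRingEnd ℂ) (w j))) * Complex.I_sq

/-- `C` drops out because `Yᴴ` annihilates `ψ`, by `⟨w, ψ⟩ = 0`. This is why `Y` is chosen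
non-Hermitian. -/
lemma trace_mul_witness (hw : H.mat *ᵥ ψ = w + (h : ℂ) • ψ) (hu : H.mat *ᵥ w = u + (h : ℂ) • w)
    (hψ : star ψ ⬝ᵥ ψ = 1) (hψw : star ψ ⬝ᵥ w = 0) (a c C : ℝ) :
    (vecMulVec ψ (star ψ) * witness H a C ((-(Complex.I * c)) • vecMulVec w (star ψ))).trace.re =
      (2 * c - a * c ^ 2) * ‖WithLp.toLp 2 w‖ ^ 2 := by
  have hwψ : star w ⬝ᵥ ψ = 0 := by
    rw [Matrix.star_dotProduct, hψw, star_zero]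
  have huψ : star ψ ⬝ᵥ u = star w ⬝ᵥ w := by
    have h1 : star ψ ⬝ᵥ (H.mat *ᵥ w) = star w ⬝ᵥ w := by
      have h2 := congrArg star hw
      rw [star_mulVec, H.isHermitian.eq] at h2
      rw [Matrix.dotProduct_mulVec, h2, star_add, star_smul, add_dotProduct, smul_dotProduct, hψw,
        smul_zero, add_zero]
    rw [hu, dotProduct_add, dotProduct_smul, hψw, smul_zero, add_zero] at h1
    exact h1
  have hψu : star u ⬝ᵥ ψ = star (star w ⬝ᵥ w) := by
    rw [Matrix.star_dotProduct, huψ]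
  rw [witness_eq hw hu hψ hψw, trace_vecMulVec_star_mul, norm_toLp_sq]
  simp only [sub_mulVec, add_mulVec, smul_mulVec, vecMulVec_star_mulVec, dotProduct_sub,
    dotProduct_add, dotProduct_smul, huψ, hψu, hψ, hψw, hwψ, smul_eq_mul, mul_zero, mul_one,
    one_mul, sub_zero, zero_add]
  rw [Complex.sub_re, Complex.re_ofReal_mul, Complex.re_ofReal_mul, Complex.add_re,
    Complex.star_def, Complex.conj_re]
  ring

open scoped Matrix.Norms.L2Operator in
lemma norm_witness_le (hw : H.mat *ᵥ ψ = w + (h : ℂ) • ψ) (hu : H.mat *ᵥ w = u + (h : ℂ) • w)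
    (hψ : star ψ ⬝ᵥ ψ = 1) (hψw : star ψ ⬝ᵥ w = 0) {a c C : ℝ} (ha : 0 ≤ a) (hc : 0 ≤ c)
    (hC : 0 ≤ C) {B : ℝ} (hwB : ‖WithLp.toLp 2 w‖ ^ 2 ≤ B) (huB : ‖WithLp.toLp 2 u‖ ≤ B) :
    ‖witness H a C ((-(Complex.I * c)) • vecMulVec w (star ψ))‖ ≤
      (4 * c + 2 * (a * c ^ 2) + C * c ^ 2) * B := by
  rw [witness_eq hw hu hψ hψw]
  have hψ1 : ‖WithLp.toLp 2 ψ‖ = 1 := by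
    rw [← sq_eq_sq₀ (norm_nonneg _) zero_le_one, norm_toLp_sq, hψ]
    simp
  have n1 : ‖vecMulVec u (star ψ)‖ ≤ B :=
    (norm_vecMulVec_le _ _).trans (by rwa [hψ1, mul_one])
  have n2 : ‖vecMulVec ψ (star u)‖ ≤ B :=
    (norm_vecMulVec_le _ _).trans (by rwa [hψ1, one_mul])
  have n3 : ‖vecMulVec w (star w)‖ ≤ B :=
    (norm_vecMulVec_le _ _).trans (by rwa [← sq])
  have n4 : ‖(star w ⬝ᵥ w) • vecMulVec ψ (star ψ)‖ ≤ B := by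
    rw [norm_smul]
    have h1 : ‖star w ⬝ᵥ w‖ ≤ B := by linarith [two_mul_norm_dotProduct_le w w]
    have h2 := norm_vecMulVec_le ψ ψ
    rw [hψ1, one_mul] at h2
    exact (mul_le_of_le_one_right (norm_nonneg _) h2).trans h1
  have hac : 0 ≤ a * c ^ 2 := by positivity
  have hCc : 0 ≤ C * c ^ 2 := by positivity
  refine (norm_sub_le _ _).trans ?_
  rw [norm_smul, Complex.norm_of_nonneg hCc]
  have e1 := (norm_sub_le ((c : ℂ) • (vecMulVec u (star ψ) + vecMulVec ψ (star u)
        - vecMulVec w (star w) - vecMulVec w (star w))) (((a * c ^ 2 : ℝ) : ℂ) •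
        (vecMulVec w (star w) + (star w ⬝ᵥ w) • vecMulVec ψ (star ψ))))
  rw [norm_smul, norm_smul, Complex.norm_of_nonneg hc, Complex.norm_of_nonneg hac] at e1
  have e2 : ‖vecMulVec u (star ψ) + vecMulVec ψ (star u)
        - vecMulVec w (star w) - vecMulVec w (star w)‖ ≤ 4 * B := by
    refine (norm_sub_le _ _).trans ?_
    have := norm_sub_le (vecMulVec u (star ψ) + vecMulVec ψ (star u)) (vecMulVec w (star w))
    have := norm_add_le (vecMulVec u (star ψ)) (vecMulVec ψ (star u))
    linarith
  have e3 : ‖vecMulVec w (star w) + (star w ⬝ᵥ w) • vecMulVec ψ (star ψ)‖ ≤ 2 * B := by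
    refine (norm_add_le _ _).trans ?_
    linarith
  have := mul_le_mul_of_nonneg_left e2 hc
  have := mul_le_mul_of_nonneg_left e3 hac
  have := mul_le_mul_of_nonneg_left n3 hCc
  linarith

/-- A lower bound on the skew information of a state close to a state that is mapped close to a
pure state by a covariant channel. -/
lemma le_skewInfo_of_near_pure (hf : IsRegularStandardMonotone f) {η C : ℝ}
    (hη : 0 ≤ η) (hC : 0 ≤ C) (hm : ∀ x y : ℝ, 0 ≤ x → 0 ≤ y →
      opMean f x y ≤ (f 0 + η) * (x + y) + C * (x * y / (x + y)))
    {H' : Hamiltonian d'} {E : QChannel d' d} (hE : E.IsCovariant H' H) (ρ σ : QState d')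
    (hw : H.mat *ᵥ ψ = w + (h : ℂ) • ψ) (hu : H.mat *ᵥ w = u + (h : ℂ) • w)
    (hψ : star ψ ⬝ᵥ ψ = 1) (hψw : star ψ ⬝ᵥ w = 0)
    {B : ℝ} (hwB : ‖WithLp.toLp 2 w‖ ^ 2 ≤ B) (huB : ‖WithLp.toLp 2 u‖ ≤ B) :
    (1 - η / f 0) * ‖WithLp.toLp 2 w‖ ^ 2 -
      f 0 * ((4 * (f 0)⁻¹ + 2 * ((f 0 + η) * (f 0)⁻¹ ^ 2) + C * (f 0)⁻¹ ^ 2) * B *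
        (2 * traceDist ρ.mat σ.mat +
          2 * traceDist (E.toLin ρ.mat) (vecMulVec ψ (star ψ)))) ≤ skewInfo f σ H' := by
  have h0 := hf.zero_pos
  -- The coefficient `c = 1 / f 0` maximizes `2 * c - f 0 * c ^ 2`; the maximum `1 / f 0` cancels
  -- the prefactor `f 0`.
  refine le_trans ?_ (trace_witness_le_skewInfo hf hη hC hm hE σ
    ((-(Complex.I * ((f 0)⁻¹ : ℝ))) • vecMulVec w (star ψ)))
  have h1 := trace_mul_sub_le (ρ := ρ.mat) (σ := σ.mat) (φ := vecMulVec ψ (star ψ))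
    (Z := witness H (f 0 + η) C ((-(Complex.I * ((f 0)⁻¹ : ℝ))) • vecMulVec w (star ψ))) E
  rw [trace_mul_witness hw hu hψ hψw] at h1
  have h2 := norm_witness_le hw hu hψ hψw (a := f 0 + η) (c := (f 0)⁻¹) (by positivity)
    (by positivity) hC hwB huB
  have h3 := mul_le_mul_of_nonneg_right h2 (show 0 ≤ 2 * traceDist ρ.mat σ.mat +
          2 * traceDist (E.toLin ρ.mat) (vecMulVec ψ (star ψ)) from
      add_nonneg (mul_nonneg zero_le_two (traceDist_nonneg _ _))
        (mul_nonneg zero_le_two (traceDist_nonneg _ _)))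
  have h4 : (1 - η / f 0) * ‖WithLp.toLp 2 w‖ ^ 2 =
      f 0 * ((2 * (f 0)⁻¹ - (f 0 + η) * (f 0)⁻¹ ^ 2) * ‖WithLp.toLp 2 w‖ ^ 2) := by
    field_simp
    ring
  rw [h4, ← mul_sub]
  exact mul_le_mul_of_nonneg_left (by linarith) h0.le

end Witness

end Pure

/-! ### Coherence bits -/

section CoherenceBits

/-- The deviation of the number of ones from `k / 2`. -/
noncomputable def deviation {k : ℕ} (a : Fin k → Fin 2) : ℝ := ∑ j, (((a j : ℕ) : ℝ) - 1 / 2)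

/-- Splitting off one bit shifts the deviation by `± 1 / 2`, a recursion for all binomial moments.
-/
lemma sum_pow_deviation_succ (k p : ℕ) :
    ∑ a : Fin (k + 1) → Fin 2, deviation a ^ p =
      ∑ a : Fin k → Fin 2, ((deviation a - 1 / 2) ^ p + (deviation a + 1 / 2) ^ p) := by
  rw [← (Fin.consEquiv fun _ : Fin (k + 1) => Fin 2).sum_comp, Fintype.sum_prod_type,
    Fin.sum_univ_two, ← Finset.sum_add_distrib]
  refine Finset.sum_congr rfl fun a _ => ?_
  congr 2 <;>
  · simp [deviation, Fin.sum_univ_succ, Fin.consEquiv]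
    ring

lemma sum_deviation (k : ℕ) : ∑ a : Fin k → Fin 2, deviation a = 0 := by
  induction k with
  | zero => simp [deviation]
  | succ k ih =>
    have := sum_pow_deviation_succ k 1
    simp only [pow_one] at this
    rw [this]
    have : ∀ a : Fin k → Fin 2, deviation a - 1 / 2 + (deviation a + 1 / 2) = 2 * deviation a :=
      fun a => by ring
    simp only [this, ← Finset.mul_sum, ih, mul_zero]

lemma sum_deviation_sq (k : ℕ) : ∑ a : Fin k → Fin 2, deviation a ^ 2 = 2 ^ k * (k / 4) := by
  induction k with
  | zero => simp [deviation]
  | succ k ih =>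
    rw [sum_pow_deviation_succ k 2]
    have : ∀ a : Fin k → Fin 2, (deviation a - 1 / 2) ^ 2 + (deviation a + 1 / 2) ^ 2 =
        2 * deviation a ^ 2 + 1 / 2 := fun a => by ring
    simp only [this, Finset.sum_add_distrib, ← Finset.mul_sum, ih]
    simp
    ring

/-- The fourth moment is quadratic in `k`, so `(H - k / 2) ^ 2` applied to the coherence bits has
norm `O(k)`. -/
lemma sum_deviation_pow_four (k : ℕ) :
    ∑ a : Fin k → Fin 2, deviation a ^ 4 = 2 ^ k * ((3 * k ^ 2 - 2 * k) / 16) := by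
  induction k with
  | zero => simp [deviation]
  | succ k ih =>
    rw [sum_pow_deviation_succ k 4]
    have : ∀ a : Fin k → Fin 2, (deviation a - 1 / 2) ^ 4 + (deviation a + 1 / 2) ^ 4 =
        2 * deviation a ^ 4 + 3 * deviation a ^ 2 + 1 / 8 := fun a => by ring
    simp only [this, Finset.sum_add_distrib, ← Finset.mul_sum, ih, sum_deviation_sq]
    simp
    ring

/-- The vector `φ_coh^{⊗ k}`. -/
noncomputable def cohVecPow (k : ℕ) (a : Fin k → Fin 2) : ℂ := ∏ j, cohVec (a j)

lemma cohState_tensorPow_mat (k : ℕ) :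
    (cohState.tensorPow k).mat = vecMulVec (cohVecPow k) (star (cohVecPow k)) := by
  ext a b
  simp [QState.tensorPow, tensorMat, cohState, vecMulVec_apply, cohVecPow, Finset.prod_mul_distrib]

lemma star_cohVecPow_mul (k : ℕ) (a : Fin k → Fin 2) :
    star (cohVecPow k a) * cohVecPow k a = (((2 : ℝ) ^ k)⁻¹ : ℝ) := by
  have h : star (cohVecPow k a) * cohVecPow k a = ∏ _j : Fin k, ((1 / 2 : ℝ) : ℂ) := by
    rw [cohVecPow, star_prod, ← Finset.prod_mul_distrib]
    refine Finset.prod_congr rfl fun j _ => ?_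
    rw [cohVec, Complex.star_def, Complex.conj_ofReal, ← Complex.ofReal_mul, div_mul_div_comm,
      Real.mul_self_sqrt (by norm_num), one_mul]
  rw [h]
  simp

lemma cohHamiltonian_copies_mat (k : ℕ) :
    (cohHamiltonian.copies k).mat =
      diagonal fun a => ((deviation a : ℝ) : ℂ) + ((k / 2 : ℝ) : ℂ) := by
  ext a b
  simp only [Hamiltonian.copies, Matrix.sum_apply]
  have hcoh : cohHamiltonian.mat = diagonal fun x : Fin 2 => ((x : ℕ) : ℂ) := by
    ext i j
    fin_cases i <;> fin_cases j <;> simp [cohHamiltonian]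
  have h : ∀ i : Fin k, tensorMat (Function.update (fun _ => (1 : Matrix (Fin 2) (Fin 2) ℂ)) i
      cohHamiltonian.mat) a b = if a = b then ((a i : ℕ) : ℂ) else 0 := by
    intro i
    rw [tensorMat, of_apply]
    split_ifs with hab
    · subst hab
      rw [Finset.prod_eq_single i]
      · simp [hcoh]
      · intro j _ hj
        simp [Function.update_of_ne hj]
      · simp
    · obtain ⟨j, hj⟩ := Function.ne_iff.1 hab
      refine Finset.prod_eq_zero (Finset.mem_univ j) ?_
      rcases eq_or_ne j i with rfl | hji
      · simp [hcoh, diagonal_apply_ne _ hj]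
      · simp [Function.update_of_ne hji, one_apply_ne hj]
  rw [Finset.sum_congr rfl fun i _ => h i]
  by_cases hab : a = b
  · subst hab
    simp [deviation]
    ring
  · simp [hab]

/-- The vector `(H - k / 2) ^ p φ_coh^{⊗ k}`. -/
noncomputable def cohVecMoment (k p : ℕ) (a : Fin k → Fin 2) : ℂ :=
  ((deviation a ^ p : ℝ) : ℂ) * cohVecPow k a

lemma cohVecMoment_zero (k : ℕ) : cohVecMoment k 0 = cohVecPow k := by
  ext a
  simp [cohVecMoment]

lemma copies_mulVec_cohVecMoment (k p : ℕ) :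
    (cohHamiltonian.copies k).mat *ᵥ cohVecMoment k p =
      cohVecMoment k (p + 1) + (((k / 2 : ℝ) : ℝ) : ℂ) • cohVecMoment k p := by
  ext a
  rw [cohHamiltonian_copies_mat, mulVec_diagonal]
  simp only [cohVecMoment, Pi.add_apply, Pi.smul_apply, smul_eq_mul]
  push_cast
  ring

/-- Measured in the computational basis, coherence bits are uniform random bits, so these inner
products are central binomial moments. -/
lemma star_cohVecMoment_dotProduct (k p q : ℕ) :
    star (cohVecMoment k p) ⬝ᵥ cohVecMoment k q =
      (((∑ a : Fin k → Fin 2, deviation a ^ (p + q)) / 2 ^ k : ℝ) : ℂ) := by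
  rw [dotProduct, Finset.sum_div, Complex.ofReal_sum]
  refine Finset.sum_congr rfl fun a _ => ?_
  have h : star (cohVecMoment k p) a * cohVecMoment k q a =
      ((deviation a ^ p * deviation a ^ q : ℝ) : ℂ) *
        (star (cohVecPow k a) * cohVecPow k a) := by
    rw [Pi.star_apply, cohVecMoment, cohVecMoment, star_mul', Complex.star_def, Complex.conj_ofReal]
    push_cast
    ring
  rw [h, star_cohVecPow_mul, ← Complex.ofReal_mul, pow_add, div_eq_mul_inv]

lemma norm_cohVecMoment_one_sq (k : ℕ) : ‖WithLp.toLp 2 (cohVecMoment k 1)‖ ^ 2 = k / 4 := by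
  rw [norm_toLp_sq, star_cohVecMoment_dotProduct, Complex.ofReal_re, sum_deviation_sq]
  field_simp

lemma norm_cohVecMoment_two_le (k : ℕ) : ‖WithLp.toLp 2 (cohVecMoment k 2)‖ ≤ k := by
  refine le_of_sq_le_sq ?_ (Nat.cast_nonneg k)
  rw [norm_toLp_sq, star_cohVecMoment_dotProduct, Complex.ofReal_re, sum_deviation_pow_four]
  field_simp
  nlinarith [Nat.cast_nonneg (α := ℝ) k]

variable {d : Type*} [Fintype d] [DecidableEq d] {f : ℝ → ℝ}

lemma skewInfo_map_cohState_le (hf : IsRegularStandardMonotone f) {k : ℕ} {H : Hamiltonian d}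
    {E : QChannel (Fin k → Fin 2) d} (hE : E.IsCovariant (cohHamiltonian.copies k) H) :
    skewInfo f (E.map (cohState.tensorPow k)) H ≤ k / 4 := by
  have hw := copies_mulVec_cohVecMoment k 0
  rw [cohVecMoment_zero] at hw
  rw [← norm_cohVecMoment_one_sq]
  exact skewInfo_map_le hf hE (cohState_tensorPow_mat k) hw

/-- If `ρ` is mapped close to `k` coherence bits by a covariant channel, then the skew information
of the states close to `ρ` is not much smaller than `k / 4`. -/
lemma exists_le_smoothSkewInfo (hf : IsRegularStandardMonotone f) {δ : ℝ} (hδ : 0 < δ) :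
    ∃ ε₀ : ℝ, 0 < ε₀ ∧ ∀ {d : Type*} [Fintype d] [DecidableEq d] {k : ℕ} {H : Hamiltonian d}
      {E : QChannel d (Fin k → Fin 2)}, E.IsCovariant H (cohHamiltonian.copies k) →
      ∀ ρ : QState d, traceDist (E.toLin ρ.mat) (cohState.tensorPow k).mat ≤ ε₀ →
      (((1 / 4 - δ) * k : ℝ) : EReal) ≤ smoothSkewInfo f ε₀ ρ H := by
  have h0 := hf.zero_pos
  -- With this `η`, the factor `1 - η / f 0` costs `δ * k / 2`. The other half of the allowed loss
  -- `δ * k` is spent on the trace distances.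
  have hη : 0 < f 0 * (2 * δ) := by positivity
  obtain ⟨C, hC, hm⟩ := hf.exists_opMean_le hη
  set L := f 0 * (4 * (f 0)⁻¹ + 2 * ((f 0 + f 0 * (2 * δ)) * (f 0)⁻¹ ^ 2) + C * (f 0)⁻¹ ^ 2)
    with hL
  have hLpos : 0 < L := by positivity
  -- Both distances are at most `ε₀`, so the perturbation is at most `4 * L * k * ε₀ = δ * k / 2`.
  -- `L` depends on neither `k` nor the system.
  refine ⟨δ / (8 * L), by positivity, fun {d} _ _ {k H E} hE ρ hρ => ?_⟩
  refine le_iInf₂ fun σ hσ => EReal.coe_le_coe_iff.2 ?_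
  have hw := copies_mulVec_cohVecMoment k 0
  rw [cohVecMoment_zero] at hw
  have hψ : star (cohVecPow k) ⬝ᵥ cohVecPow k = 1 := by
    rw [← cohVecMoment_zero, star_cohVecMoment_dotProduct]
    simp
  have hψw : star (cohVecPow k) ⬝ᵥ cohVecMoment k 1 = 0 := by
    rw [← cohVecMoment_zero, star_cohVecMoment_dotProduct]
    simp [sum_deviation]
  have hk : (0 : ℝ) ≤ k := Nat.cast_nonneg k
  have h1 := le_skewInfo_of_near_pure hf hη.le hC hm hE ρ σ hw (copies_mulVec_cohVecMoment k 1)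
    hψ hψw (B := k) (by rw [norm_cohVecMoment_one_sq]; linarith) (norm_cohVecMoment_two_le k)
  rw [norm_cohVecMoment_one_sq, ← cohState_tensorPow_mat, mul_div_cancel_left₀ _ h0.ne',
    ← mul_assoc, ← mul_assoc, ← hL] at h1
  have h2 : L * k * (2 * traceDist ρ.mat σ.mat + 2 * traceDist (E.toLin ρ.mat)
      (cohState.tensorPow k).mat) ≤ L * k * (4 * (δ / (8 * L))) :=
    mul_le_mul_of_nonneg_left (by linarith [show traceDist ρ.mat σ.mat ≤ δ / (8 * L) from hσ])
      (by positivity)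
  have h3 : L * k * (4 * (δ / (8 * L))) = δ / 2 * k := by
    field_simp
    ring
  linarith

end CoherenceBits

/-! ### Rates -/

section Main

variable {d : ℕ → Type*} [∀ m, Fintype (d m)] [∀ m, DecidableEq (d m)] {f : ℝ → ℝ}

lemma AsympConvertible.eventually_traceDist_le {d' : ℕ → Type*}
    [∀ m, Fintype (d' m)] [∀ m, DecidableEq (d' m)]
    {ρ : ∀ m, QState (d m)} {H : ∀ m, Hamiltonian (d m)}
    {σ : ∀ m, QState (d' m)} {H' : ∀ m, Hamiltonian (d' m)} (h : AsympConvertible ρ H σ H')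
    {ε : ℝ} (hε : 0 < ε) :
    ∃ E : ∀ m, QChannel (d m) (d' m), (∀ m, (E m).IsCovariant (H m) (H' m)) ∧
      ∀ᶠ m in atTop, traceDist ((E m).toLin (ρ m).mat) (σ m).mat ≤ ε := by
  -- An error strictly below `ε` turns the bound on the limit superior into an eventual one; the cap
  -- `1` comes from the definition of convertibility.
  obtain ⟨E, hE, hlim⟩ := h (min (ε / 2) 1) (by positivity) (min_le_right _ _)
  refine ⟨E, hE, ?_⟩
  have h1 := eventually_lt_of_limsup_lt (hlim.trans_lt (b := ((min (ε / 2) 1 : ℝ) : EReal))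
    (c := (ε : EReal)) (EReal.coe_lt_coe_iff.2 ((min_le_left _ _).trans_lt (by linarith))))
  filter_upwards [h1] with m hm
  exact (EReal.coe_lt_coe_iff.1 hm).le

lemma tendsto_ceil_mul_div {R : ℝ} (hR : 0 ≤ R) :
    Tendsto (fun m : ℕ => 1 / (m : ℝ) * ((⌈R * m⌉₊ : ℝ) / 4)) atTop (𝓝 (R / 4)) := by
  have h := (tendsto_nat_ceil_mul_div_atTop hR).comp tendsto_natCast_atTop_atTop
  refine (h.div_const 4).congr fun m => ?_
  simp only [Function.comp]
  ring

lemma four_mul_supRate_le_cohCost (hf : IsRegularStandardMonotone f)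
    (ρ : ∀ m, QState (d m)) (H : ∀ m, Hamiltonian (d m)) :
    4 * supRate f ρ H ≤ cohCost ρ H := by
  refine le_sInf ?_
  rintro _ ⟨R, ⟨hR, hconv⟩, rfl⟩
  have key : supRate f ρ H ≤ ((R / 4 : ℝ) : EReal) := by
    refine le_of_tendsto (tendsto_supRate f ρ H) ?_
    filter_upwards [self_mem_nhdsWithin] with ε (hε : 0 < ε)
    obtain ⟨E, hE, hdist⟩ := hconv.eventually_traceDist_le hε
    have hlim := (continuous_coe_real_ereal.tendsto _).comp (tendsto_ceil_mul_div hR)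
    rw [← hlim.limsup_eq]
    refine limsup_le_limsup ?_
    filter_upwards [hdist] with m hm
    rw [Function.comp_apply, EReal.coe_mul]
    refine mul_le_mul_of_nonneg_left ?_ (EReal.coe_nonneg.2 (by positivity))
    -- The channel output itself competes in the infimum over the ball.
    refine (iInf₂_le ((E m).map (cohStates R m)) ?_).trans
      (EReal.coe_le_coe_iff.2 (skewInfo_map_cohState_le hf (hE m)))
    change traceDist _ _ ≤ ε
    rw [traceDist_comm]
    exact hm
  refine (mul_le_mul_of_nonneg_left key (by norm_num)).trans_eq ?_
  rw [show (4 : EReal) = ((4 : ℝ) : EReal) from rfl, ← EReal.coe_mul]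
  congr 1
  ring

lemma infRate_le_supRate (f : ℝ → ℝ) (ρ : ∀ m, QState (d m)) (H : ∀ m, Hamiltonian (d m)) :
    infRate f ρ H ≤ supRate f ρ H :=
  le_of_tendsto_of_tendsto' (tendsto_infRate f ρ H) (tendsto_supRate f ρ H) fun _ =>
    liminf_le_limsup

lemma cohDist_le_four_mul_infRate (hf : IsRegularStandardMonotone f)
    (ρ : ∀ m, QState (d m)) (H : ∀ m, Hamiltonian (d m)) :
    cohDist ρ H ≤ 4 * infRate f ρ H := by
  refine sSup_le ?_
  rintro _ ⟨R, ⟨hR, hconv⟩, rfl⟩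
  have key : ∀ δ : ℝ, 0 < δ → δ < 1 / 4 →
      (((1 / 4 - δ) * R : ℝ) : EReal) ≤ infRate f ρ H := by
    intro δ hδ hδ4
    obtain ⟨ε₀, hε₀, hlow⟩ := exists_le_smoothSkewInfo hf hδ
    refine ge_of_tendsto (tendsto_infRate f ρ H) ?_
    filter_upwards [Ioo_mem_nhdsGT hε₀] with ε hε
    -- Shrinking the ball raises the smooth skew information, so the bound at `ε₀` suffices.
    refine le_trans ?_ (infRateAt_antitone f ρ H hε.2.le)
    obtain ⟨E, hE, hdist⟩ := hconv.eventually_traceDist_le hε₀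
    refine le_liminf_of_le (by isBoundedDefault) ?_
    -- `m = 0` is excluded because `1 / m` then has the default value `0`.
    filter_upwards [hdist, eventually_gt_atTop 0] with m hm hm0
    refine le_trans ?_ (mul_le_mul_of_nonneg_left (hlow (hE m) (ρ m) hm)
      (EReal.coe_nonneg.2 (by positivity)))
    rw [← EReal.coe_mul, EReal.coe_le_coe_iff]
    have hm' : (0 : ℝ) < m := Nat.cast_pos.2 hm0
    have h1 : R * m ≤ ⌈R * m⌉₊ := Nat.le_ceil _
    rw [one_div_mul_eq_div (m : ℝ), le_div_iff₀ hm', mul_assoc]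
    exact mul_le_mul_of_nonneg_left h1 (by linarith)
  have hlim : Tendsto (fun δ : ℝ => (((1 / 4 - δ) * R : ℝ) : EReal)) (𝓝[>] 0)
      (𝓝 (((1 / 4 - 0) * R : ℝ) : EReal)) := by
    refine (continuous_coe_real_ereal.tendsto _).comp ?_
    have : Continuous fun δ : ℝ => (1 / 4 - δ) * R := by fun_prop
    exact (this.tendsto 0).mono_left nhdsWithin_le_nhds
  have h1 : (((1 / 4 - 0) * R : ℝ) : EReal) ≤ infRate f ρ H := by
    refine le_of_tendsto hlim ?_
    filter_upwards [Ioo_mem_nhdsGT (show (0 : ℝ) < 1 / 4 by norm_num)] with δ hδ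
    exact key δ hδ.1 hδ.2
  refine le_trans (le_of_eq ?_) (mul_le_mul_of_nonneg_left h1 (by norm_num))
  rw [show (4 : EReal) = ((4 : ℝ) : EReal) from rfl, ← EReal.coe_mul]
  congr 1
  ring

end Main

end Asymmetry

theorem theorem3 {d : ℕ → Type*} [∀ m, Fintype (d m)] [∀ m, DecidableEq (d m)]
    (f : ℝ → ℝ) (hf : Asymmetry.IsRegularStandardMonotone f)
    (ρ : ∀ m, Asymmetry.QState (d m)) (H : ∀ m, Asymmetry.Hamiltonian (d m)) :
    Asymmetry.cohCost ρ H ≥ 4 * Asymmetry.supRate f ρ H ∧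
    4 * Asymmetry.supRate f ρ H ≥ 4 * Asymmetry.infRate f ρ H ∧
    4 * Asymmetry.infRate f ρ H ≥ Asymmetry.cohDist ρ H :=
  ⟨Asymmetry.four_mul_supRate_le_cohCost hf ρ H,
    mul_le_mul_of_nonneg_left (Asymmetry.infRate_le_supRate f ρ H) (by norm_num),
    Asymmetry.cohDist_le_four_mul_infRate hf ρ H⟩
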